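/- **Setting.** Let $1\le d_0\le d$ be integers. Let $X=(X_1,\dots,X_d)$ have independent coordinates with densities, and let $X\in\Omega$ a.s. for an open set $\Omega\subseteq\mathbb R^d$. Let $X'=(X'_1,\dots,X'_d)$ have independent coordinates with distribution functions $G_j$ and densities $g_j$ satisfying $g_j\ge\rho_{\min}>0$ on their supports ($G_j$-almost surely). For $w\subseteq\{1,\dots,d\}$ write $\mathcal D^{|w|}=\prod_{k\in w}\partial/\partial x_k$ (weak derivative). Let $\mathcal M:\mathbb R^d\to\mathbb R$ satisfy: * $\mathcal M\in W^{d,2}$: $\mathcal M$ and all weak derivatives $\mathcal D^{|v|}\mathcal M$ on $\Omega$, $v\subseteq\{1,\dots,d\}$, are square integrable under the law of $X$; * $\mathcal M\in\mathcal H_\alpha$ with constant $M_\alpha>0$ for every integer $0\le\alpha\le\max(d,d_0+2)$, i.e. for all $x,y\in\mathbb R^d$, $\bigl|\mathcal M(x)-\sum_{\|i\|_1\le\alpha-1}\frac{\mathcal D^{(i)}\mathcal M(y)}{i!}(x-y)^i\bigr|\le M_\alpha\|x-y\|^\alpha$ (weak derivatives, Euclidean norm); * $\mathcal M\in\mathcal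 L_{d_0,0}$ (no interactions above order $d_0$), i.e. for all $x\in\Omega$, $$\mathcal M(x)=\sum_{|w|\le d_0}\mathbb E\Bigl[\mathcal D^{|w|}\mathcal M(X')\prod_{k\in w}\tfrac{G_k(X'_k)-\mathbf 1_{X'_k\ge x_k}}{g_k(X'_k)}\Bigr].$$ Put $r^*=d_0-1$ and $L=d_0+1$. Let $\beta_1,\dots,\beta_L$ be distinct reals and let $C^{(p)}_\ell$ ($1\le p\le d_0$, $1\le\ell\le L$) be reals with $\sum_\ell C^{(p)}_\ell\beta_\ell^r=\delta_{p,r}$ for $r=0,\dots,d_0-1$ together with $r=p+2\lfloor (d_0-1-p)/2\rfloor+2$ if $p\le d_0-1$, respectively $r=d_0$ if $p=d_0$. Let $\xi>0$, let $V=(V_1,\dots,V_d)$ have i.i.d. coordinates uniform on $(-\xi,\xi)$, and let $\sigma^2=\mathbb E[V_1^2]$. Let $h=aN^{-\eta}$ with $a>0$ and $\eta\in(1/4,1)$. From two independent i.i.d. samples $X'_1,\dots,X'_N$ of $X'$ and $V_1,\dots,V_N$ of $V$ form the truncated emulator $$\widehat{\mathcal M^c_{N,d_0}}(x)=\frac1N\sum_{i=1}^N\sum_{\ell=1}^L\sum_{p=1}^{d_0}C^{(p)}_\ell\,\mathcal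 M(X'_i+\beta_\ell hV_i)\sum_{|w|=p}\prod_{k\in w}\frac{G_k(X'_{i,k})-\mathbf 1_{X'_{i,k}\ge x_k}}{g_k(X'_{i,k})\,h\,\sigma^2}V_{i,k}$$ of $\mathcal M^c(x)=\mathcal M(x)-\mathbb E[\mathcal M(X')]$. Its MSE at $x$ is $\mathbb E[(\widehat{\mathcal M^c_{N,d_0}}(x)-\mathcal M^c(x))^2]$, and its IMSE is the expectation of the MSE over $x=X$. Write $F=\max_{1\le p\le d_0}M_p\sum_\ell|C^{(p)}_\ell\beta_\ell^p|$, $\Gamma_{d_0+2}=\sum_\ell|C^{(d_0)}_\ell\beta_\ell^{d_0+2}|$ and $d_0^*=\frac{(d-1)\ln2}{\ln d}$ (read as $0$ for $d=1$), and assume $$\xi^2\le\Bigl(d\,M_{d_0+2}\Gamma_{d_0+2}\tbinom d{d_0}\bigl(\tfrac1{2\rho_{\min}}\bigr)^{d_0}\Bigr)^{-1}.$$ **Claim.** (i) If $d+0.8\ge3\rho_{\min}^2$, then for all $N\ge1$ the MSE at every $x\in\Omega$ and the IMSE are at most $B/N+R_N$ with $R_N=O(N^{-1})$, where $$B=F^2\Bigl[2\Bigl(\tfrac{d(d+0.8)}{3\rho_{\min}^2}\Bigr)^{d_0}\mathbf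 1_{d_0\le d_0^*}+2^d\Bigl(\tfrac{d+0.8}{3\rho_{\min}^2}\Bigr)^{d_0}\mathbf 1_{d_0>d_0^*}\Bigr].$$ (ii) If $\rho_{\min}=\sqrt{c_0d(d+0.8)/3}$ with $1<c_0\le2$, then for all $N\ge1$ the MSE at every $x\in\Omega$ and the IMSE are at most $\frac{F^2}{N(c_0-1)}+R_N$ with $R_N=O(N^{-1})$. In both cases the sequence $(R_N)$ depends only on $d,d_0,\beta,C,(M_\alpha)_\alpha,\rho_{\min},\xi,a,\eta$ (and $c_0$), not on $\mathcal M$, $\Omega$, $x$ or the distributions of $X$ and $X'$. Moreover, for all sufficiently large $N$, $N R_N\le\kappa(d)B$ in (i), with $\kappa(d)$ depending only on $d$, and $N R_N\le\kappa_0F^2$ in (ii), with $\kappa_0$ an absolute constant, so that the bound in (ii) is dimension-free. -/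

import Mathlib

open MeasureTheory ProbabilityTheory Filter Asymptotics
open scoped ContDiff Topology

noncomputable section

namespace DbAnova

/-! ### Weak partial derivatives and function spaces -/

/-- The iterated classical partial derivative `∂^i φ` of a test function, `i` a multi-index. -/
def partialDeriv {d : ℕ} (i : Fin d → ℕ) (φ : (Fin d → ℝ) → ℝ) : (Fin d → ℝ) → ℝ :=
  (List.finRange d).foldr
    (fun k f => (fun (u : (Fin d → ℝ) → ℝ) (x : Fin d → ℝ) =>
      fderiv ℝ u x (Pi.single k 1))^[i k] f) φ

/-- `g` is a weak partial derivative of `f` of multi-index `i` on the open set `U`. -/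
def IsWeakPartial {d : ℕ} (U : Set (Fin d → ℝ)) (i : Fin d → ℕ) (f g : (Fin d → ℝ) → ℝ) : Prop :=
  LocallyIntegrableOn f U ∧ LocallyIntegrableOn g U ∧
    ∀ φ : (Fin d → ℝ) → ℝ, ContDiff ℝ ∞ φ → HasCompactSupport φ → tsupport φ ⊆ U →
      ∫ x, f x * partialDeriv i φ x = (-1) ^ (∑ k, i k) * ∫ x, g x * φ x

/-- The multi-index `1_w` of the cross-partial derivative `𝒟^{|w|} = ∏_{k ∈ w} ∂/∂x_k`. -/
def crossIndex {d : ℕ} (w : Finset (Fin d)) : Fin d → ℕ := fun k => if k ∈ w then 1 else 0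

/-- The Euclidean norm of a vector. -/
def euclid {d : ℕ} (x : Fin d → ℝ) : ℝ := ‖WithLp.toLp 2 x‖

/-- `M` belongs to the Hölder space `ℋ_α` with constant `c`; `D i` is the (weak) partial derivative
of `M` of multi-index `i`. The sum runs over all multi-indices of length at most `α - 1`. -/
def MemHolder {d : ℕ} (M : (Fin d → ℝ) → ℝ) (D : (Fin d → ℕ) → (Fin d → ℝ) → ℝ)
    (α : ℕ) (c : ℝ) : Prop :=
  (∀ i : Fin d → ℕ, ∑ k, i k < α → IsWeakPartial Set.univ i M (D i)) ∧
  ∀ x y : Fin d → ℝ,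
    |M x - ∑ r ∈ Finset.range α, ∑ i ∈ Finset.piAntidiag (Finset.univ : Finset (Fin d)) r,
        D i y / (∏ k, ((i k).factorial : ℝ)) * ∏ k, (x k - y k) ^ i k|
      ≤ c * euclid (x - y) ^ α

/-! ### Inputs -/

/-- The law on `ℝ` with density `g`. -/
def densityLaw (g : ℝ → ℝ) : Measure ℝ := volume.withDensity fun t => ENNReal.ofReal (g t)

/-- `g` is a probability density function on `ℝ`. -/
def IsPDF (g : ℝ → ℝ) : Prop :=
  Measurable g ∧ (∀ t, 0 ≤ g t) ∧ IsProbabilityMeasure (densityLaw g)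

/-- The law of a random vector with independent coordinates of densities `g j`. -/
def inputLaw {d : ℕ} (g : Fin d → ℝ → ℝ) : Measure (Fin d → ℝ) :=
  Measure.pi fun j => densityLaw (g j)

/-- `M` belongs to the Hilbert-Sobolev space `W^{d,2}` on `Ω` for the input law `μ`. -/
def MemHilbertSobolev {d : ℕ} (Ω : Set (Fin d → ℝ)) (μ : Measure (Fin d → ℝ))
    (M : (Fin d → ℝ) → ℝ) (D : (Fin d → ℕ) → (Fin d → ℝ) → ℝ) : Prop :=
  MemLp M 2 μ ∧ ∀ v : Finset (Fin d),
    IsWeakPartial Ω (crossIndex v) M (D (crossIndex v)) ∧ MemLp (D (crossIndex v)) 2 μ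

/-- The weight `(G(t) - 1_{t ≥ x}) / g(t)`, `G` being the distribution function of the density `g`. -/
def weight (g : ℝ → ℝ) (x t : ℝ) : ℝ :=
  (cdf (densityLaw g) t - if x ≤ t then 1 else 0) / g t

/-- `M` belongs to `ℒ_{α,B}` on `Ω`: up to the error `B`, it is the sum of the terms of order at
most `α` of its derivative-based ANOVA expansion with respect to the densities `g j`. -/
def MemInteraction {d : ℕ} (Ω : Set (Fin d → ℝ)) (g : Fin d → ℝ → ℝ)
    (M : (Fin d → ℝ) → ℝ) (D : (Fin d → ℕ) → (Fin d → ℝ) → ℝ) (α : ℕ) (B : ℝ) : Prop :=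
  ∀ x ∈ Ω, |M x - ∑ w : Finset (Fin d) with w.card ≤ α,
    ∫ t, D (crossIndex w) t * ∏ k ∈ w, weight (g k) (x k) (t k) ∂(inputLaw g)| ≤ B

/-! ### The emulator -/

/-- The `p`-th elementary symmetric polynomial. -/
def esp {d : ℕ} (p : ℕ) (r : Fin d → ℝ) : ℝ :=
  ∑ w ∈ Finset.powersetCard p (Finset.univ : Finset (Fin d)), ∏ k ∈ w, r k

/-- The uniform law on `(-ξ, ξ)`. -/
def uniformLaw (ξ : ℝ) : Measure ℝ := ProbabilityTheory.cond volume (Set.Ioo (-ξ) ξ)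

/-- The constraints on the coefficients `C_1^{(p)}, …, C_L^{(p)}`. -/
def CoeffConstraints (rs L : ℕ) (β : Fin L → ℝ) (p : ℕ) (c : Fin L → ℝ) : Prop :=
  if p ≤ rs then
    ∀ r : ℕ, (r ≤ rs ∨ ∃ j, 1 ≤ j ∧ j ≤ L - 1 - rs ∧ r = p + 2 * ((rs - p) / 2) + 2 * j) →
      ∑ l, c l * β l ^ r = if p = r then 1 else 0
  else
    ∀ r : ℕ, (r ≤ rs ∨ ∃ j, j ≤ L - rs - 2 ∧ r = p + 2 * j) →
      ∑ l, c l * β l ^ r = if p = r then 1 else 0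

/-- `Γ_r = ∑_ℓ |C_ℓ^{(p)} β_ℓ^r|`, for the coefficients `C^{(p)}`. -/
def Gam {L : ℕ} (β : Fin L → ℝ) (C : ℕ → Fin L → ℝ) (p r : ℕ) : ℝ := ∑ l, |C p l * β l ^ r|

/-- `Ϝ_{d₀}^{max} = max_{1 ≤ p ≤ d₀} M_p Γ_p`. -/
def digamma {L : ℕ} (β : Fin L → ℝ) (C : ℕ → Fin L → ℝ) (Mc : ℕ → ℝ) (d₀ : ℕ) (h : 1 ≤ d₀) : ℝ :=
  (Finset.Icc 1 d₀).sup' (Finset.nonempty_Icc.mpr h) fun p => Mc p * Gam β C p p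

/-- The variables `R_k(x_k, X'_k, V_k)`, with bandwidths `h` and variance `s = σ²` of the `V_k`. -/
def Rvec {d : ℕ} (g : Fin d → ℝ → ℝ) (h : Fin d → ℝ) (s : ℝ) (x t v : Fin d → ℝ) : Fin d → ℝ :=
  fun k => weight (g k) (x k) (t k) / (h k * s) * v k

/-- The truncated emulator of order `d₀` at the point `x`, computed from the points
`t i` (values of `X'_i`) and `v i` (values of `V_i`), `i = 1, …, N`. -/
def emulator {d L N : ℕ} (M : (Fin d → ℝ) → ℝ) (g : Fin d → ℝ → ℝ) (β : Fin L → ℝ)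
    (C : ℕ → Fin L → ℝ) (h : Fin d → ℝ) (s : ℝ) (d₀ : ℕ)
    (t v : Fin N → Fin d → ℝ) (x : Fin d → ℝ) : ℝ :=
  (1 / (N : ℝ)) * ∑ i, ∑ l, ∑ p ∈ Finset.Icc 1 d₀,
    C p l * M (fun k => t i k + β l * h k * v i k) * esp p (Rvec g h s x (t i) (v i))

/-- The centred output `M^c(x) = M(x) - E[M(X')]`. -/
def centred {d : ℕ} (M : (Fin d → ℝ) → ℝ) (g : Fin d → ℝ → ℝ) (x : Fin d → ℝ) : ℝ :=
  M x - ∫ t, M t ∂(inputLaw g)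

/-- `(X'_i)_i` and `(V_i)_i` are two independent i.i.d. samples of size `N`, the first from the
densities `g j`, the second with independent coordinates uniform on `(-ξ, ξ)`. -/
def IsSample {d N : ℕ} {S : Type*} [MeasurableSpace S] (P : Measure S) (g : Fin d → ℝ → ℝ) (ξ : ℝ)
    (X' V : Fin N → S → Fin d → ℝ) : Prop :=
  (∀ i, Measurable (X' i)) ∧ (∀ i, Measurable (V i)) ∧
  iIndepFun (fun i s => (X' i s, V i s)) P ∧
  ∀ i, P.map (fun s => (X' i s, V i s)) =
    (inputLaw g).prod (Measure.pi fun _ : Fin d => uniformLaw ξ)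

/-- The mean squared error at `x` of the truncated emulator built from the sample, with the
uniform bandwidth `h`, as an extended nonnegative real. -/
def MSE {d L N : ℕ} {S : Type*} [MeasurableSpace S] (P : Measure S)
    (M : (Fin d → ℝ) → ℝ) (g : Fin d → ℝ → ℝ) (β : Fin L → ℝ) (C : ℕ → Fin L → ℝ)
    (h ξ : ℝ) (d₀ : ℕ) (X' V : Fin N → S → Fin d → ℝ) (x : Fin d → ℝ) : ENNReal :=
  ∫⁻ s, ENNReal.ofReal
    ((emulator M g β C (fun _ => h) (∫ v, v ^ 2 ∂(uniformLaw ξ)) d₀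
        (fun i => X' i s) (fun i => V i s) x - centred M g x) ^ 2) ∂P

/-- The assumptions on the model and the inputs: `X` has independent coordinates with densities
`f j` and lies in the open set `Ω`, `X'` has independent coordinates with densities
`g j ≥ ρ` (on their supports), `M ∈ W^{d,2}`, `M ∈ ℋ_α` with constant `Mc α` for all
`α ≤ max (d, d₀ + 2)`, and `M ∈ ℒ_{d₀,0}`. -/
structure Admissible {d : ℕ} (d₀ : ℕ) (Mc : ℕ → ℝ) (ρ : ℝ) (Ω : Set (Fin d → ℝ))
    (f g : Fin d → ℝ → ℝ) (M : (Fin d → ℝ) → ℝ) (D : (Fin d → ℕ) → (Fin d → ℝ) → ℝ) : Prop where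
  isOpen : IsOpen Ω
  pdf_X : ∀ j, IsPDF (f j)
  supported : ∀ᵐ x ∂(inputLaw f), x ∈ Ω
  pdf_X' : ∀ j, IsPDF (g j)
  lower : ∀ j, ∀ᵐ t ∂(densityLaw (g j)), ρ ≤ g j t
  sobolev : MemHilbertSobolev Ω (inputLaw f) M D
  holder : ∀ α ≤ max d (d₀ + 2), MemHolder M D α (Mc α)
  interaction : MemInteraction Ω g M D d₀ 0

/-- The MSE and the IMSE of the truncated emulator with bandwidth `a N^{-η}` are at most
`B / N + R N`, where `R N = O(N⁻¹)` and moreover `N * R N ≤ K` for all large `N`. The remainder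
`R` is uniform over the models, the distributions of the inputs and the points `x`. -/
def ErrorBound {L : ℕ} (d d₀ : ℕ) (β : Fin L → ℝ) (C : ℕ → Fin L → ℝ) (Mc : ℕ → ℝ)
    (ρ ξ a η B K : ℝ) : Prop :=
  ∃ R : ℕ → ℝ, (R =O[atTop] fun N : ℕ => (N : ℝ)⁻¹) ∧ (∀ᶠ N : ℕ in atTop, N * R N ≤ K) ∧
    ∀ (Ω : Set (Fin d → ℝ)) (f g : Fin d → ℝ → ℝ) (M : (Fin d → ℝ) → ℝ)
      (D : (Fin d → ℕ) → (Fin d → ℝ) → ℝ), Admissible d₀ Mc ρ Ω f g M D →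
    ∀ (N : ℕ), 1 ≤ N →
    ∀ (S : Type*) [MeasurableSpace S] (P : Measure S) [IsProbabilityMeasure P]
      (X' V : Fin N → S → Fin d → ℝ), IsSample P g ξ X' V →
      (∀ x ∈ Ω, MSE P M g β C (a * (N : ℝ) ^ (-η)) ξ d₀ X' V x ≤ ENNReal.ofReal (B / N + R N)) ∧
      ∫⁻ x, MSE P M g β C (a * (N : ℝ) ^ (-η)) ξ d₀ X' V x ∂(inputLaw f)
        ≤ ENNReal.ofReal (B / N + R N)

/-- The threshold `d₀^* = (d - 1) ln 2 / ln d`. -/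
def dStar (d : ℕ) : ℝ := ((d : ℝ) - 1) * Real.log 2 / Real.log d

/-- `F² [2 (d(d+0.8)/(3ρ²))^{d₀} 1_{d₀ ≤ d₀^*} + 2^d ((d+0.8)/(3ρ²))^{d₀} 1_{d₀ > d₀^*}]`. -/
def mainConst (d d₀ : ℕ) (ρ F : ℝ) : ℝ :=
  F ^ 2 * (if (d₀ : ℝ) ≤ dStar d then 2 * ((d : ℝ) * (d + 0.8) / (3 * ρ ^ 2)) ^ d₀
    else 2 ^ d * (((d : ℝ) + 0.8) / (3 * ρ ^ 2)) ^ d₀)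

end DbAnova

end

namespace DbAnova

/-! ### The uniform law -/

/-! The emulator is the mean of `N` i.i.d. copies of one summand (`emulatorTerm`), so its MSE is at
most the second moment of that summand over `N`, plus the squared bias (`integral_sq_mean_sub_le`).

Second moment. The order-`p` coefficients annihilate powers below `p`, so the Hölder condition of
order `p` bounds the finite difference by `F h^p ‖V‖^p`. This cancels the `h^{-p}` of the weights.
Squarefree monomials in `V` are orthogonal, and `‖V‖² ≤ dξ² = 3dσ²`, so `h` and `ξ` both disappear:
the bound is `F² ∑ₚ C(d,p) (6d/ρ²)^p` (`integral_emulatorTerm_sq_le`).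

Bias. In the Taylor expansion to order `p + 1`, testing against `∏_{k ∈ w} V_k` with `|w| = p` keeps
only the cross-partial along `w`: lower orders are killed by the coefficients, the rest of order `p`
by orthogonality, order `p + 1` by parity. The error is `O(h²)`
(`abs_integral_fdiff_mul_prod_sub_le`). Integrated against the weights, the cross-partials sum to
`M^c(x)` by the interaction hypothesis, so the squared bias is `O(N^{-4η}) = o(1/N)`.

The remainder is only required to be `O(1/N)` with controlled constant, so the whole variance bound
is placed in `R`, and `B / N` enters only through its sign. It remains to compare the moment sum
with `B` up to a factor `19^d`, and in (ii) with `e^18`. -/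

theorem isProbabilityMeasure_uniformLaw {ξ : ℝ} (hξ : 0 < ξ) :
    IsProbabilityMeasure (uniformLaw ξ) := by
  refine cond_isProbabilityMeasure_of_finite ?_ ?_
  · simp [Real.volume_Ioo]; linarith
  · simp [Real.volume_Ioo]

theorem ae_mem_uniformLaw (ξ : ℝ) : ∀ᵐ v ∂(uniformLaw ξ), v ∈ Set.Ioo (-ξ) ξ :=
  ae_cond_mem measurableSet_Ioo

theorem integral_pow_uniformLaw {ξ : ℝ} (hξ : 0 < ξ) (n : ℕ) :
    ∫ v, v ^ n ∂(uniformLaw ξ) = (ξ ^ (n + 1) - (-ξ) ^ (n + 1)) / (n + 1) / (2 * ξ) := by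
  have h2 : (ENNReal.ofReal (ξ - -ξ))⁻¹.toReal = (2 * ξ)⁻¹ := by
    rw [ENNReal.toReal_inv, ENNReal.toReal_ofReal (by linarith)]; ring
  rw [uniformLaw, ProbabilityTheory.cond, integral_smul_measure, Real.volume_Ioo, h2,
    ← integral_Ioc_eq_integral_Ioo, ← intervalIntegral.integral_of_le (by linarith), integral_pow,
    smul_eq_mul]
  ring

theorem integral_sq_uniformLaw {ξ : ℝ} (hξ : 0 < ξ) :
    ∫ v, v ^ 2 ∂(uniformLaw ξ) = ξ ^ 2 / 3 := by
  rw [integral_pow_uniformLaw hξ]; field_simp; norm_num; ring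

theorem integral_pow_uniformLaw_of_odd {ξ : ℝ} (hξ : 0 < ξ) {n : ℕ} (hn : Odd n) :
    ∫ v, v ^ n ∂(uniformLaw ξ) = 0 := by
  rw [integral_pow_uniformLaw hξ, hn.add_one.neg_pow]; simp

/-- The law of a vector with independent coordinates uniform on `(-ξ, ξ)`. -/
noncomputable abbrev cubeLaw (d : ℕ) (ξ : ℝ) : Measure (Fin d → ℝ) := Measure.pi fun _ : Fin d => uniformLaw ξ

theorem isProbabilityMeasure_cubeLaw (d : ℕ) {ξ : ℝ} (hξ : 0 < ξ) :
    IsProbabilityMeasure (cubeLaw d ξ) := by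
  have := isProbabilityMeasure_uniformLaw hξ
  infer_instance

theorem ae_pi_of_forall_ae {d : ℕ} {μ : Fin d → Measure ℝ} [∀ j, IsProbabilityMeasure (μ j)]
    {p : Fin d → ℝ → Prop} (h : ∀ j, ∀ᵐ t ∂(μ j), p j t) :
    ∀ᵐ t ∂(Measure.pi μ), ∀ j, p j (t j) :=
  ae_all_iff.2 fun j => (Measure.quasiMeasurePreserving_eval μ j).ae (h j)

theorem ae_abs_le_cubeLaw (d : ℕ) {ξ : ℝ} (hξ : 0 < ξ) :
    ∀ᵐ v ∂(cubeLaw d ξ), ∀ k, |v k| ≤ ξ := by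
  have := isProbabilityMeasure_uniformLaw hξ
  filter_upwards [ae_pi_of_forall_ae (d := d) fun _ => ae_mem_uniformLaw ξ] with v hv k
  exact abs_le.2 ⟨(hv k).1.le, (hv k).2.le⟩

theorem integrable_cubeLaw_of_continuous {d : ℕ} {ξ : ℝ} (hξ : 0 < ξ) {f : (Fin d → ℝ) → ℝ}
    (hf : Continuous f) : Integrable f (cubeLaw d ξ) := by
  have := isProbabilityMeasure_cubeLaw d hξ
  obtain ⟨c, hc⟩ := (isCompact_univ_pi fun _ : Fin d => isCompact_Icc (a := -ξ) (b := ξ)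
    ).exists_bound_of_continuousOn hf.continuousOn
  refine Integrable.of_bound hf.aestronglyMeasurable c ?_
  filter_upwards [ae_abs_le_cubeLaw d hξ] with v hv
  exact hc v fun k _ => abs_le.1 (hv k)

theorem integral_monomial_cubeLaw {d : ℕ} {ξ : ℝ} (hξ : 0 < ξ) (n : Fin d → ℕ) :
    ∫ v, ∏ k, v k ^ n k ∂(cubeLaw d ξ) = ∏ k, ∫ t, t ^ n k ∂(uniformLaw ξ) := by
  have := isProbabilityMeasure_uniformLaw hξ
  exact integral_fintype_prod_eq_prod (𝕜 := ℝ) (fun k t => t ^ n k)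

theorem prod_eq_prod_pow_crossIndex {d : ℕ} (w : Finset (Fin d)) (v : Fin d → ℝ) :
    ∏ k ∈ w, v k = ∏ k, v k ^ crossIndex w k := by
  simp [crossIndex, Finset.prod_ite_mem, pow_ite]

theorem sum_crossIndex {d : ℕ} (w : Finset (Fin d)) : ∑ k, crossIndex w k = w.card := by
  simp [crossIndex]

theorem prod_factorial_crossIndex {d : ℕ} (w : Finset (Fin d)) :
    ∏ k, ((crossIndex w k).factorial : ℝ) = 1 :=
  Finset.prod_eq_one fun k _ => by unfold crossIndex; split_ifs <;> simp

theorem crossIndex_injective {d : ℕ} : Function.Injective (crossIndex (d := d)) := by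
  intro w w' h
  ext k
  have := congrFun h k
  by_cases h1 : k ∈ w <;> by_cases h2 : k ∈ w' <;> simp_all [crossIndex]

theorem integral_monomial_mul_prod {d : ℕ} {ξ : ℝ} (hξ : 0 < ξ) (n : Fin d → ℕ)
    (w : Finset (Fin d)) :
    ∫ v, (∏ k, v k ^ n k) * ∏ k ∈ w, v k ∂(cubeLaw d ξ)
      = ∏ k, ∫ t, t ^ (n k + crossIndex w k) ∂(uniformLaw ξ) := by
  rw [← integral_monomial_cubeLaw hξ]
  congr with v
  rw [prod_eq_prod_pow_crossIndex w, ← Finset.prod_mul_distrib]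
  simp [pow_add]

/-- An odd total degree forces an odd exponent in some coordinate, whose moment vanishes by
symmetry. -/
theorem integral_monomial_mul_prod_of_odd {d : ℕ} {ξ : ℝ} (hξ : 0 < ξ) (n : Fin d → ℕ)
    (w : Finset (Fin d)) (h : Odd (∑ k, n k + w.card)) :
    ∫ v, (∏ k, v k ^ n k) * ∏ k ∈ w, v k ∂(cubeLaw d ξ) = 0 := by
  rw [integral_monomial_mul_prod hξ]
  by_contra h0
  rw [← sum_crossIndex, ← Finset.sum_add_distrib] at h
  refine (Nat.not_even_iff_odd.2 h) (Finset.even_sum _ fun k _ => ?_)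
  by_contra hk
  exact h0 (Finset.prod_eq_zero (Finset.mem_univ k)
    (integral_pow_uniformLaw_of_odd hξ (Nat.not_even_iff_odd.1 hk)))

/-- A nonzero integral needs every exponent `n k + 1_w(k)` even, hence `n k ≥ 1` on `w`; equality of
total degrees then leaves only `n = 1_w`. -/
theorem integral_monomial_mul_prod_of_sum_eq {d : ℕ} {ξ : ℝ} (hξ : 0 < ξ) (n : Fin d → ℕ)
    (w : Finset (Fin d)) (h : ∑ k, n k = w.card) :
    ∫ v, (∏ k, v k ^ n k) * ∏ k ∈ w, v k ∂(cubeLaw d ξ)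
      = if n = crossIndex w then (∫ t, t ^ 2 ∂(uniformLaw ξ)) ^ w.card else 0 := by
  have := isProbabilityMeasure_uniformLaw hξ
  rw [integral_monomial_mul_prod hξ]
  split_ifs with hn
  · subst hn
    rw [← Finset.prod_const, ← Finset.prod_subset (Finset.subset_univ w)]
    · refine Finset.prod_congr rfl fun k hk => ?_
      simp [crossIndex, hk]
    · intro k _ hk
      simp [crossIndex, hk]
  · by_contra h0
    have hev : ∀ k, Even (n k + crossIndex w k) := fun k => by
      by_contra hk
      exact h0 (Finset.prod_eq_zero (Finset.mem_univ k)
        (integral_pow_uniformLaw_of_odd hξ (Nat.not_even_iff_odd.1 hk)))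
    have hle : ∀ k, crossIndex w k ≤ n k := fun k => by
      have := hev k
      unfold crossIndex at this ⊢
      split_ifs at this ⊢
      · rcases Nat.eq_zero_or_pos (n k) with h | h
        · simp [h] at this
        · exact h
      · exact Nat.zero_le _
    rw [← sum_crossIndex] at h
    exact hn (funext fun k =>
      ((Finset.sum_eq_sum_iff_of_le fun k _ => hle k).1 h.symm k (Finset.mem_univ k)).symm)

/-! ### Finite differences of Hölder functions -/

theorem euclid_nonneg {d : ℕ} (v : Fin d → ℝ) : 0 ≤ euclid v := norm_nonneg _

theorem euclid_smul {d : ℕ} (b : ℝ) (v : Fin d → ℝ) : euclid (b • v) = |b| * euclid v := by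
  rw [euclid, WithLp.toLp_smul, norm_smul, Real.norm_eq_abs, euclid]

theorem continuous_euclid {d : ℕ} : Continuous (euclid (d := d)) :=
  (PiLp.continuous_toLp 2 _).norm

theorem euclid_sq_le {d : ℕ} {ξ : ℝ} {v : Fin d → ℝ} (hv : ∀ k, |v k| ≤ ξ) :
    euclid v ^ 2 ≤ d * ξ ^ 2 := by
  rw [euclid, EuclideanSpace.norm_sq_eq]
  calc ∑ k, ‖v k‖ ^ 2 ≤ ∑ _k : Fin d, ξ ^ 2 :=
        Finset.sum_le_sum fun k _ => pow_le_pow_left₀ (norm_nonneg _) (hv k) 2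
    _ = d * ξ ^ 2 := by simp

theorem euclid_le {d : ℕ} {ξ : ℝ} (hξ : 0 ≤ ξ) {v : Fin d → ℝ} (hv : ∀ k, |v k| ≤ ξ) :
    euclid v ≤ Real.sqrt d * ξ := by
  refine abs_le_of_sq_le_sq' ?_ (by positivity) |>.2
  rw [mul_pow, Real.sq_sqrt (Nat.cast_nonneg d)]
  exact euclid_sq_le hv

/-- The homogeneous part of order `r` of the Taylor polynomial at `t`, with derivatives `D`. -/
noncomputable def taylorPart {d : ℕ} (D : (Fin d → ℕ) → (Fin d → ℝ) → ℝ) (r : ℕ) (t v : Fin d → ℝ) : ℝ :=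
  ∑ i ∈ Finset.piAntidiag (Finset.univ : Finset (Fin d)) r,
    D i t / (∏ k, ((i k).factorial : ℝ)) * ∏ k, v k ^ i k

/-- The finite difference `∑ l, c l * M (t + β l * h * v)`. -/
noncomputable def fdiff {d L : ℕ} (β c : Fin L → ℝ) (M : (Fin d → ℝ) → ℝ) (h : ℝ) (t v : Fin d → ℝ) : ℝ :=
  ∑ l, c l * M (fun k => t k + β l * h * v k)

/-- At order `0` the Taylor sum is empty and the right-hand side is constant: `ℋ_0` is boundedness.
-/
theorem MemHolder.abs_le {d : ℕ} {M : (Fin d → ℝ) → ℝ} {D : (Fin d → ℕ) → (Fin d → ℝ) → ℝ}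
    {c : ℝ} (H : MemHolder M D 0 c) (x : Fin d → ℝ) : |M x| ≤ c := by
  simpa using H.2 x x

/-- Evaluating the bound at `x = y` gives equality at every point, not merely almost everywhere.
This later identifies the order-zero ANOVA term with `E[M(X')]`. -/
theorem MemHolder.deriv_zero {d : ℕ} {M : (Fin d → ℝ) → ℝ}
    {D : (Fin d → ℕ) → (Fin d → ℝ) → ℝ} {c : ℝ} (H : MemHolder M D 1 c) : D 0 = M := by
  ext y
  have := H.2 y y
  simp [euclid] at this
  linarith

theorem MemHolder.continuous {d : ℕ} {M : (Fin d → ℝ) → ℝ}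
    {D : (Fin d → ℕ) → (Fin d → ℝ) → ℝ} {c : ℝ} (H : MemHolder M D 1 c) : Continuous M := by
  rw [continuous_iff_continuousAt]
  intro y
  have h0 : Tendsto (fun x => c * euclid (x - y) ^ 1) (𝓝 y) (𝓝 0) := by
    have : Continuous fun x : Fin d → ℝ => c * euclid (x - y) ^ 1 := by
      have := continuous_euclid (d := d)
      fun_prop
    simpa [euclid] using this.tendsto y
  rw [ContinuousAt, tendsto_iff_norm_sub_tendsto_zero]
  refine squeeze_zero (fun _ => norm_nonneg _) (fun x => ?_) h0
  have := H.2 x y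
  simpa [H.deriv_zero] using this

theorem MemHolder.abs_sub_taylor_le {d : ℕ} {M : (Fin d → ℝ) → ℝ}
    {D : (Fin d → ℕ) → (Fin d → ℝ) → ℝ} {α : ℕ} {c : ℝ} (H : MemHolder M D α c)
    (b : ℝ) (t v : Fin d → ℝ) :
    |M (fun k => t k + b * v k) - ∑ r ∈ Finset.range α, b ^ r * taylorPart D r t v|
      ≤ c * (|b| ^ α * euclid v ^ α) := by
  have h := H.2 (fun k => t k + b * v k) t
  have e : (fun k => t k + b * v k) - t = b • v := by ext k; simp
  rw [e, euclid_smul, mul_pow] at h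
  refine le_of_eq_of_le ?_ h
  congr 2
  refine Finset.sum_congr rfl fun r _ => ?_
  rw [taylorPart, Finset.mul_sum]
  refine Finset.sum_congr rfl fun i hi => ?_
  have hs : ∑ k, i k = r := by simpa using hi
  have : ∏ k, (t k + b * v k - t k) ^ i k = b ^ r * ∏ k, v k ^ i k := by
    rw [← hs, ← Finset.prod_pow_eq_pow_sum, ← Finset.prod_mul_distrib]
    exact Finset.prod_congr rfl fun k _ => by rw [add_sub_cancel_left, mul_pow]
  rw [this]; ring

/-- Taylor expansion at each node `β l * h`, followed by an exchange of sums, makes the expansion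
depend on the nodes only through the moments `∑ c_l β_l^r`. -/
theorem MemHolder.abs_fdiff_sub_le {d L : ℕ} {M : (Fin d → ℝ) → ℝ}
    {D : (Fin d → ℕ) → (Fin d → ℝ) → ℝ} {α : ℕ} {A : ℝ} (H : MemHolder M D α A)
    (β c : Fin L → ℝ) {h : ℝ} (hh : 0 < h) (t v : Fin d → ℝ) :
    |fdiff β c M h t v
        - ∑ r ∈ Finset.range α, (∑ l, c l * β l ^ r) * (h ^ r * taylorPart D r t v)|
      ≤ A * (∑ l, |c l * β l ^ α|) * (h ^ α * euclid v ^ α) := by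
  have e : fdiff β c M h t v
        - ∑ r ∈ Finset.range α, (∑ l, c l * β l ^ r) * (h ^ r * taylorPart D r t v)
      = ∑ l, c l * (M (fun k => t k + β l * h * v k)
          - ∑ r ∈ Finset.range α, (β l * h) ^ r * taylorPart D r t v) := by
    simp only [mul_sub, Finset.sum_sub_distrib, fdiff, Finset.mul_sum, Finset.sum_mul]
    rw [Finset.sum_comm]
    congr 1
    refine Finset.sum_congr rfl fun l _ => Finset.sum_congr rfl fun r _ => ?_
    rw [mul_pow]; ring
  rw [e, Finset.mul_sum, Finset.sum_mul]
  refine (Finset.abs_sum_le_sum_abs _ _).trans (Finset.sum_le_sum fun l _ => ?_)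
  rw [abs_mul]
  refine (mul_le_mul_of_nonneg_left (H.abs_sub_taylor_le (β l * h) t v)
    (abs_nonneg _)).trans_eq ?_
  rw [abs_mul, abs_mul, abs_pow, abs_of_pos hh]; ring

theorem abs_fdiff_le {d L : ℕ} {M : (Fin d → ℝ) → ℝ} {A : ℝ} (hM : ∀ x, |M x| ≤ A)
    (β c : Fin L → ℝ) (h : ℝ) (t v : Fin d → ℝ) :
    |fdiff β c M h t v| ≤ (∑ l, |c l|) * A := by
  rw [fdiff, Finset.sum_mul]
  refine (Finset.abs_sum_le_sum_abs _ _).trans (Finset.sum_le_sum fun l _ => ?_)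
  rw [abs_mul]
  exact mul_le_mul_of_nonneg_left (hM _) (abs_nonneg _)

theorem continuous_fdiff {d L : ℕ} {M : (Fin d → ℝ) → ℝ} (hM : Continuous M)
    (β c : Fin L → ℝ) (h : ℝ) :
    Continuous fun q : (Fin d → ℝ) × (Fin d → ℝ) => fdiff β c M h q.1 q.2 := by
  unfold fdiff
  fun_prop

/-- The coefficients of order `p ≤ d₀` annihilate the powers below `p` and normalise the power
`p`. -/
theorem CoeffConstraints.sum_eq {d₀ p : ℕ} (hp : p ∈ Finset.Icc 1 d₀) {β c : Fin (d₀ + 1) → ℝ}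
    (H : CoeffConstraints (d₀ - 1) (d₀ + 1) β p c) {r : ℕ} (hr : r ≤ p) :
    ∑ l, c l * β l ^ r = if p = r then 1 else 0 := by
  have hp' := Finset.mem_Icc.1 hp
  unfold CoeffConstraints at H
  split_ifs at H with h
  · exact H r (Or.inl (by omega))
  · rcases hr.lt_or_eq with h1 | h1
    · exact H r (Or.inl (by omega))
    · exact H r (Or.inr ⟨0, by omega, by omega⟩)

theorem one_le_Gam {L p : ℕ} {β : Fin L → ℝ} {C : ℕ → Fin L → ℝ}
    (H : ∑ l, C p l * β l ^ p = 1) : 1 ≤ Gam β C p p := by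
  rw [← H]
  exact (le_abs_self _).trans (Finset.abs_sum_le_sum_abs _ _)

/-- The Taylor polynomial of degree `p - 1` drops out because the moments below `p` vanish, leaving
only the remainder. No smallness of `h` is needed. -/
theorem abs_fdiff_le_digamma {d d₀ p : ℕ} (hd₀ : 1 ≤ d₀) (hp : p ∈ Finset.Icc 1 d₀)
    {M : (Fin d → ℝ) → ℝ} {D : (Fin d → ℕ) → (Fin d → ℝ) → ℝ} {Mc : ℕ → ℝ}
    (H : MemHolder M D p (Mc p)) {β : Fin (d₀ + 1) → ℝ} {C : ℕ → Fin (d₀ + 1) → ℝ}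
    (hC : CoeffConstraints (d₀ - 1) (d₀ + 1) β p (C p)) {h : ℝ} (hh : 0 < h) (t v : Fin d → ℝ) :
    |fdiff β (C p) M h t v| ≤ digamma β C Mc d₀ hd₀ * (h ^ p * euclid v ^ p) := by
  have h1 := H.abs_fdiff_sub_le β (C p) hh t v
  rw [Finset.sum_eq_zero, sub_zero] at h1
  · refine h1.trans (mul_le_mul_of_nonneg_right ?_ ?_)
    · exact Finset.le_sup' (fun p => Mc p * Gam β C p p) hp
    · have := euclid_nonneg v
      positivity
  · intro r hr
    have hr := Finset.mem_range.1 hr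
    rw [hC.sum_eq hp hr.le, if_neg hr.ne', zero_mul]

theorem digamma_pos {d₀ : ℕ} (hd₀ : 1 ≤ d₀) {β : Fin (d₀ + 1) → ℝ} {C : ℕ → Fin (d₀ + 1) → ℝ}
    {Mc : ℕ → ℝ} (hC : ∀ p ∈ Finset.Icc 1 d₀, CoeffConstraints (d₀ - 1) (d₀ + 1) β p (C p))
    (hMc : 0 < Mc 1) : 0 < digamma β C Mc d₀ hd₀ := by
  have h1 : 1 ∈ Finset.Icc 1 d₀ := Finset.mem_Icc.2 ⟨le_rfl, hd₀⟩
  refine lt_of_lt_of_le ?_ (Finset.le_sup' (fun p => Mc p * Gam β C p p) h1)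
  have := one_le_Gam (p := 1) (β := β) (C := C) (by rw [(hC 1 h1).sum_eq h1 le_rfl, if_pos rfl])
  positivity

/-! ### Expectation of the finite differences -/

theorem continuous_taylorPart {d : ℕ} (D : (Fin d → ℕ) → (Fin d → ℝ) → ℝ) (r : ℕ)
    (t : Fin d → ℝ) : Continuous (taylorPart D r t) := by
  unfold taylorPart
  fun_prop

theorem integral_taylorPart_mul_prod {d : ℕ} {ξ : ℝ} (hξ : 0 < ξ)
    (D : (Fin d → ℕ) → (Fin d → ℝ) → ℝ) (r : ℕ) (t : Fin d → ℝ) (w : Finset (Fin d)) :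
    ∫ v, taylorPart D r t v * ∏ k ∈ w, v k ∂(cubeLaw d ξ)
      = ∑ i ∈ Finset.piAntidiag (Finset.univ : Finset (Fin d)) r,
        D i t / (∏ k, ((i k).factorial : ℝ)) *
          ∫ v, (∏ k, v k ^ i k) * ∏ k ∈ w, v k ∂(cubeLaw d ξ) := by
  simp only [taylorPart, Finset.sum_mul, mul_assoc]
  rw [integral_finsetSum]
  · simp only [integral_const_mul]
  · intro i _
    exact integrable_cubeLaw_of_continuous hξ (by fun_prop)

theorem integral_taylorPart_card_mul_prod {d : ℕ} {ξ : ℝ} (hξ : 0 < ξ)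
    (D : (Fin d → ℕ) → (Fin d → ℝ) → ℝ) (t : Fin d → ℝ) (w : Finset (Fin d)) :
    ∫ v, taylorPart D w.card t v * ∏ k ∈ w, v k ∂(cubeLaw d ξ)
      = (∫ u, u ^ 2 ∂(uniformLaw ξ)) ^ w.card * D (crossIndex w) t := by
  rw [integral_taylorPart_mul_prod hξ, Finset.sum_eq_single (crossIndex w)]
  · rw [integral_monomial_mul_prod_of_sum_eq hξ _ _ (sum_crossIndex w), if_pos rfl,
      prod_factorial_crossIndex]
    ring
  · intro i hi hne
    rw [integral_monomial_mul_prod_of_sum_eq hξ _ _ (by simpa using hi), if_neg hne, mul_zero]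
  · intro h
    exact (h (by simp [sum_crossIndex])).elim

/-- The total degree `2|w| + 1` is odd. This raises the bias from order `h` to `h²`, whatever the
moment of order `|w| + 1` of the coefficients. -/
theorem integral_taylorPart_card_succ_mul_prod {d : ℕ} {ξ : ℝ} (hξ : 0 < ξ)
    (D : (Fin d → ℕ) → (Fin d → ℝ) → ℝ) (t : Fin d → ℝ) (w : Finset (Fin d)) :
    ∫ v, taylorPart D (w.card + 1) t v * ∏ k ∈ w, v k ∂(cubeLaw d ξ) = 0 := by
  rw [integral_taylorPart_mul_prod hξ]
  refine Finset.sum_eq_zero fun i hi => ?_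
  have hs : ∑ k, i k = w.card + 1 := by simpa using hi
  rw [integral_monomial_mul_prod_of_odd hξ _ _ ⟨w.card, by omega⟩, mul_zero]

theorem abs_prod_le {d : ℕ} {ξ : ℝ} {v : Fin d → ℝ} (hv : ∀ k, |v k| ≤ ξ)
    (w : Finset (Fin d)) : |∏ k ∈ w, v k| ≤ ξ ^ w.card := by
  rw [Finset.abs_prod, ← Finset.prod_const]
  exact Finset.prod_le_prod (fun _ _ => abs_nonneg _) fun k _ => hv k

/-- Cross-partial derivatives are approximated, up to order two in the bandwidth, by expectations
of finite differences. -/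
theorem abs_integral_fdiff_mul_prod_sub_le {d L : ℕ} {ξ : ℝ} (hξ : 0 < ξ) {M : (Fin d → ℝ) → ℝ}
    {D : (Fin d → ℕ) → (Fin d → ℝ) → ℝ} {A : ℝ} (hA : 0 ≤ A) (w : Finset (Fin d))
    (H : MemHolder M D (w.card + 2) A) (hM : Continuous M) {β c : Fin L → ℝ}
    (hc : ∀ r ≤ w.card, ∑ l, c l * β l ^ r = if w.card = r then 1 else 0)
    {h : ℝ} (hh : 0 < h) (t : Fin d → ℝ) :
    |∫ v, fdiff β c M h t v * ∏ k ∈ w, (v k / (h * ∫ u, u ^ 2 ∂(uniformLaw ξ))) ∂(cubeLaw d ξ)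
        - D (crossIndex w) t|
      ≤ A * (∑ l, |c l * β l ^ (w.card + 2)|) * (Real.sqrt d * ξ) ^ (w.card + 2) * ξ ^ w.card
        / (∫ u, u ^ 2 ∂(uniformLaw ξ)) ^ w.card * h ^ 2 := by
  have := isProbabilityMeasure_cubeLaw d hξ
  set p := w.card with hp
  set s := ∫ u, u ^ 2 ∂(uniformLaw ξ) with hs
  have hs0 : 0 < s := by rw [hs, integral_sq_uniformLaw hξ]; positivity
  set T : (Fin d → ℝ) → ℝ := fun v =>
    ∑ r ∈ Finset.range (p + 2), (∑ l, c l * β l ^ r) * (h ^ r * taylorPart D r t v) with hT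
  have hTc : Continuous T := by
    have := continuous_taylorPart D
    fun_prop
  have hF : Continuous fun v => fdiff β c M h t v :=
    (continuous_fdiff hM β c h).comp (Continuous.prodMk_right t)
  have hTi : ∫ v, T v * ∏ k ∈ w, v k ∂(cubeLaw d ξ) = h ^ p * (s ^ p * D (crossIndex w) t) := by
    have e : ∀ v : Fin d → ℝ, T v * ∏ k ∈ w, v k = ∑ r ∈ Finset.range (p + 2),
        (∑ l, c l * β l ^ r) * h ^ r * (taylorPart D r t v * ∏ k ∈ w, v k) := fun v => by
      rw [hT, Finset.sum_mul]
      exact Finset.sum_congr rfl fun r _ => by ring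
    simp only [e]
    rw [integral_finsetSum]
    · simp only [integral_const_mul]
      -- The two top orders are split off: `p + 1` vanishes by parity and `p` yields the
      -- cross-partial. The moment conditions remove the others.
      rw [Finset.sum_range_succ, Finset.sum_range_succ,
        integral_taylorPart_card_succ_mul_prod hξ, integral_taylorPart_card_mul_prod hξ,
        hc p le_rfl, if_pos rfl, Finset.sum_eq_zero]
      · rw [← hs, ← hp]; ring
      · intro r hr
        have hr := Finset.mem_range.1 hr
        rw [hc r hr.le, if_neg hr.ne']; simp
    · intro r _
      have := continuous_taylorPart D r t
      exact integrable_cubeLaw_of_continuous hξ (by fun_prop)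
  have hdiff : |∫ v, (fdiff β c M h t v - T v) * ∏ k ∈ w, v k ∂(cubeLaw d ξ)|
      ≤ A * (∑ l, |c l * β l ^ (p + 2)|) * (h ^ (p + 2) * (Real.sqrt d * ξ) ^ (p + 2))
        * ξ ^ p := by
    rw [← Real.norm_eq_abs]
    refine (norm_integral_le_of_norm_le_const (C := A * (∑ l, |c l * β l ^ (p + 2)|) *
      (h ^ (p + 2) * (Real.sqrt d * ξ) ^ (p + 2)) * ξ ^ p) ?_).trans_eq (by simp)
    filter_upwards [ae_abs_le_cubeLaw d hξ] with v hv
    rw [Real.norm_eq_abs, abs_mul]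
    have h0 := euclid_nonneg v
    have h1 := euclid_le hξ.le hv
    refine mul_le_mul ((H.abs_fdiff_sub_le β c hh t v).trans ?_) (abs_prod_le hv w)
      (abs_nonneg _) (by positivity)
    gcongr
  have e2 : ∫ v, (fdiff β c M h t v - T v) * ∏ k ∈ w, v k ∂(cubeLaw d ξ)
      = (h * s) ^ p *
        (∫ v, fdiff β c M h t v * ∏ k ∈ w, (v k / (h * s)) ∂(cubeLaw d ξ)
          - D (crossIndex w) t) := by
    simp only [sub_mul]
    rw [integral_sub (integrable_cubeLaw_of_continuous hξ (by fun_prop))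
      (integrable_cubeLaw_of_continuous hξ (by fun_prop)), hTi, mul_sub, ← integral_const_mul]
    congr 1
    · congr with v
      rw [Finset.prod_div_distrib, Finset.prod_const, ← hp]
      field_simp
    · ring
  rw [e2, abs_mul, abs_of_pos (by positivity : 0 < (h * s) ^ p), ← le_div_iff₀' (by positivity)]
    at hdiff
  refine hdiff.trans_eq ?_
  rw [mul_pow h s, pow_add h]
  field_simp

/-! ### Second moments -/

/-- Distinct squarefree monomials of the same degree are orthogonal, so only the diagonal of the
squared sum survives. -/
theorem integral_esp_sq {d : ℕ} {ξ : ℝ} (hξ : 0 < ξ) (p : ℕ) (c : Fin d → ℝ) :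
    ∫ v, esp p (fun k => c k * v k) ^ 2 ∂(cubeLaw d ξ)
      = (∫ u, u ^ 2 ∂(uniformLaw ξ)) ^ p * esp p fun k => c k ^ 2 := by
  -- One of the two products is written as a monomial with exponents `crossIndex w`, the shape that
  -- the moment formulas accept.
  have e : ∀ v : Fin d → ℝ, esp p (fun k => c k * v k) ^ 2
      = ∑ w ∈ Finset.powersetCard p (Finset.univ : Finset (Fin d)),
        ∑ w' ∈ Finset.powersetCard p (Finset.univ : Finset (Fin d)),
          ((∏ k ∈ w, c k) * ∏ k ∈ w', c k) *
            ((∏ k, v k ^ crossIndex w k) * ∏ k ∈ w', v k) := fun v => by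
    rw [sq, esp, Finset.sum_mul_sum]
    refine Finset.sum_congr rfl fun w _ => Finset.sum_congr rfl fun w' _ => ?_
    rw [Finset.prod_mul_distrib, Finset.prod_mul_distrib, ← prod_eq_prod_pow_crossIndex]
    ring
  have hint : ∀ w w' : Finset (Fin d), Integrable (fun v : Fin d → ℝ =>
      ((∏ k ∈ w, c k) * ∏ k ∈ w', c k) * ((∏ k, v k ^ crossIndex w k) * ∏ k ∈ w', v k))
      (cubeLaw d ξ) := fun w w' => integrable_cubeLaw_of_continuous hξ (by fun_prop)
  simp only [e]
  rw [integral_finsetSum _ fun w _ => integrable_finsetSum _ fun w' _ => hint w w', esp,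
    Finset.mul_sum]
  refine Finset.sum_congr rfl fun w hw => ?_
  have hw := (Finset.mem_powersetCard.1 hw).2
  rw [integral_finsetSum _ fun w' _ => hint w w', Finset.sum_eq_single w]
  · rw [integral_const_mul, integral_monomial_mul_prod_of_sum_eq hξ _ _ (sum_crossIndex w),
      if_pos rfl, hw, Finset.prod_pow]
    ring
  · intro w' hw' hne
    have hw' := (Finset.mem_powersetCard.1 hw').2
    rw [integral_const_mul, integral_monomial_mul_prod_of_sum_eq hξ _ _
      (by rw [sum_crossIndex, hw, hw']), if_neg fun h => hne (crossIndex_injective h).symm,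
      mul_zero]
  · intro h
    exact (h (Finset.mem_powersetCard.2 ⟨Finset.subset_univ _, hw⟩)).elim

theorem abs_esp_le {d : ℕ} {b : ℝ} {r : Fin d → ℝ} (hr : ∀ k, |r k| ≤ b) (p : ℕ) :
    |esp p r| ≤ d.choose p * b ^ p := by
  refine (Finset.abs_sum_le_sum_abs _ _).trans ?_
  refine (Finset.sum_le_sum (g := fun _ => b ^ p) fun w hw => ?_).trans_eq ?_
  · exact (abs_prod_le hr w).trans_eq (by rw [(Finset.mem_powersetCard.1 hw).2])
  · simp

theorem esp_const_mul {d : ℕ} (p : ℕ) (b : ℝ) (r : Fin d → ℝ) :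
    esp p (fun k => b * r k) = b ^ p * esp p r := by
  rw [esp, esp, Finset.mul_sum]
  refine Finset.sum_congr rfl fun w hw => ?_
  rw [Finset.prod_mul_distrib, Finset.prod_const, (Finset.mem_powersetCard.1 hw).2]

/-- Cauchy–Schwarz with weights `2^{-p}`, whose total mass is at most one. The factors `2^p` are
later absorbed into a geometric term, so no factor `n` appears. -/
theorem sq_sum_Icc_le (n : ℕ) (a : ℕ → ℝ) :
    (∑ p ∈ Finset.Icc 1 n, a p) ^ 2 ≤ ∑ p ∈ Finset.Icc 1 n, 2 ^ p * a p ^ 2 := by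
  have h := Finset.sum_sq_le_sum_mul_sum_of_sq_le_mul (Finset.Icc 1 n) (r := a)
    (f := fun p => (1 / 2 : ℝ) ^ p) (g := fun p => 2 ^ p * a p ^ 2)
    (fun p _ => by positivity) (fun p _ => by positivity) fun p _ => by
      rw [← mul_assoc, ← mul_pow]; norm_num
  have h1 : ∑ p ∈ Finset.Icc 1 n, (1 / 2 : ℝ) ^ p ≤ 1 := by
    have : ∑ p ∈ Finset.Icc 1 n, (1 / 2 : ℝ) ^ p = 1 - (1 / 2) ^ n := by
      clear h
      induction n with
      | zero => simp
      | succ n ih => rw [Finset.sum_Icc_succ_top (by omega), ih, pow_succ]; ring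
    rw [this]
    linarith [pow_nonneg (by norm_num : (0 : ℝ) ≤ 1 / 2) n]
  refine h.trans (mul_le_of_le_one_left (Finset.sum_nonneg fun p _ => by positivity) h1)

/-! ### The summands of the emulator -/

theorem abs_weight_le {g : ℝ → ℝ} {ρ t : ℝ} (hρ : 0 < ρ) (h : ρ ≤ g t) (x : ℝ) :
    |weight g x t| ≤ 1 / ρ := by
  have h0 := cdf_nonneg (densityLaw g) t
  have h1 := cdf_le_one (densityLaw g) t
  rw [weight, abs_div, abs_of_pos (hρ.trans_le h)]
  refine div_le_div₀ zero_le_one (abs_le.2 ?_) hρ h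
  split_ifs <;> constructor <;> linarith

theorem measurable_weight {g : ℝ → ℝ} (hg : Measurable g) (x : ℝ) : Measurable (weight g x) := by
  have h1 : Measurable (cdf (densityLaw g)) := (monotone_cdf _).measurable
  have h2 : Measurable fun t : ℝ => if x ≤ t then (1 : ℝ) else 0 :=
    Measurable.ite measurableSet_Ici measurable_const measurable_const
  exact (h1.sub h2).div hg

theorem isProbabilityMeasure_inputLaw {d : ℕ} {g : Fin d → ℝ → ℝ} (hg : ∀ j, IsPDF (g j)) :
    IsProbabilityMeasure (inputLaw g) := by
  have := fun j => (hg j).2.2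
  unfold inputLaw
  infer_instance

theorem ae_abs_weight_le {d : ℕ} {g : Fin d → ℝ → ℝ} (hg : ∀ j, IsPDF (g j)) {ρ : ℝ} (hρ : 0 < ρ)
    (hl : ∀ j, ∀ᵐ t ∂(densityLaw (g j)), ρ ≤ g j t) (x : Fin d → ℝ) :
    ∀ᵐ t ∂(inputLaw g), ∀ k, |weight (g k) (x k) (t k)| ≤ 1 / ρ := by
  have := fun j => (hg j).2.2
  filter_upwards [ae_pi_of_forall_ae hl] with t ht k
  exact abs_weight_le hρ (ht k) (x k)

/-- The contribution of one sample point `q = (X', V)` to the emulator. -/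
noncomputable def emulatorTerm {d L : ℕ} (M : (Fin d → ℝ) → ℝ) (g : Fin d → ℝ → ℝ) (β : Fin L → ℝ)
    (C : ℕ → Fin L → ℝ) (h s : ℝ) (d₀ : ℕ) (x : Fin d → ℝ) (q : (Fin d → ℝ) × (Fin d → ℝ)) : ℝ :=
  ∑ p ∈ Finset.Icc 1 d₀, fdiff β (C p) M h q.1 q.2 * esp p (Rvec g (fun _ => h) s x q.1 q.2)

theorem emulator_eq {d L N : ℕ} (M : (Fin d → ℝ) → ℝ) (g : Fin d → ℝ → ℝ) (β : Fin L → ℝ)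
    (C : ℕ → Fin L → ℝ) (h s : ℝ) (d₀ : ℕ) (t v : Fin N → Fin d → ℝ) (x : Fin d → ℝ) :
    emulator M g β C (fun _ => h) s d₀ t v x
      = (1 / (N : ℝ)) * ∑ i, emulatorTerm M g β C h s d₀ x (t i, v i) := by
  simp only [emulator, emulatorTerm, fdiff, Finset.sum_mul]
  congr 1
  exact Finset.sum_congr rfl fun i _ => Finset.sum_comm

theorem esp_Rvec {d : ℕ} (p : ℕ) (g : Fin d → ℝ → ℝ) (h s : ℝ) (x t v : Fin d → ℝ) :
    esp p (Rvec g (fun _ => h) s x t v)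
      = (1 / (h * s)) ^ p * esp p fun k => weight (g k) (x k) (t k) * v k := by
  rw [← esp_const_mul]
  congr 1
  ext k
  rw [Rvec]; ring

theorem continuous_esp {d : ℕ} (p : ℕ) : Continuous (esp (d := d) p) := by
  unfold esp
  fun_prop

theorem measurable_emulatorTerm {d L : ℕ} {M : (Fin d → ℝ) → ℝ} (hM : Continuous M)
    {g : Fin d → ℝ → ℝ} (hg : ∀ j, Measurable (g j)) (β : Fin L → ℝ) (C : ℕ → Fin L → ℝ)
    (h s : ℝ) (d₀ : ℕ) (x : Fin d → ℝ) : Measurable (emulatorTerm M g β C h s d₀ x) := by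
  refine Finset.measurable_sum _ fun p _ => (continuous_fdiff hM β (C p) h).measurable.mul
    ((continuous_esp p).measurable.comp (measurable_pi_lambda _ fun k => ?_))
  have h1 : Measurable fun q : (Fin d → ℝ) × (Fin d → ℝ) => weight (g k) (x k) (q.1 k) :=
    (measurable_weight (hg k) (x k)).comp ((measurable_pi_apply k).comp measurable_fst)
  have h2 : Measurable fun q : (Fin d → ℝ) × (Fin d → ℝ) => q.2 k :=
    (measurable_pi_apply k).comp measurable_snd
  exact (h1.div_const _).mul h2

/-- A crude bound that degenerates as `h → 0`; it serves only to give square integrability for fixed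
`h`. -/
theorem abs_emulatorTerm_le {d L : ℕ} {M : (Fin d → ℝ) → ℝ} {A : ℝ} (hM : ∀ y, |M y| ≤ A)
    {g : Fin d → ℝ → ℝ} {β : Fin L → ℝ} {C : ℕ → Fin L → ℝ} {h s ρ ξ : ℝ} (hh : 0 < h)
    (hs : 0 < s) {d₀ : ℕ} {x t v : Fin d → ℝ}
    (ht : ∀ k, |weight (g k) (x k) (t k)| ≤ 1 / ρ) (hv : ∀ k, |v k| ≤ ξ) :
    |emulatorTerm M g β C h s d₀ x (t, v)| ≤ ∑ p ∈ Finset.Icc 1 d₀,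
      (∑ l, |C p l|) * A * (d.choose p * (1 / ρ / (h * s) * ξ) ^ p) := by
  refine (Finset.abs_sum_le_sum_abs _ _).trans (Finset.sum_le_sum fun p _ => ?_)
  rw [abs_mul]
  have hA : 0 ≤ A := (abs_nonneg _).trans (hM 0)
  refine mul_le_mul (abs_fdiff_le hM β (C p) h t v) (abs_esp_le (fun k => ?_) p) (abs_nonneg _)
    (by positivity)
  rw [Rvec, abs_mul, abs_div, abs_of_pos (mul_pos hh hs)]
  have := (abs_nonneg _).trans (ht k)
  gcongr
  exacts [ht k, hv k]

/-- The bound on the second moment of the summands of the emulator. -/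
noncomputable def momentConst (d d₀ : ℕ) (ρ : ℝ) : ℝ :=
  ∑ p ∈ Finset.Icc 1 d₀, d.choose p * (6 * d / ρ ^ 2) ^ p

theorem integral_emulatorTerm_sq_le {d d₀ : ℕ} (hd₀ : 1 ≤ d₀) {M : (Fin d → ℝ) → ℝ}
    {D : (Fin d → ℕ) → (Fin d → ℝ) → ℝ} {Mc : ℕ → ℝ}
    (H : ∀ p ∈ Finset.Icc 1 d₀, MemHolder M D p (Mc p)) {g : Fin d → ℝ → ℝ}
    {β : Fin (d₀ + 1) → ℝ} {C : ℕ → Fin (d₀ + 1) → ℝ}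
    (hC : ∀ p ∈ Finset.Icc 1 d₀, CoeffConstraints (d₀ - 1) (d₀ + 1) β p (C p))
    {h ρ ξ : ℝ} (hh : 0 < h) (hξ : 0 < ξ) {x t : Fin d → ℝ}
    (ht : ∀ k, |weight (g k) (x k) (t k)| ≤ 1 / ρ) :
    ∫ v, emulatorTerm M g β C h (∫ u, u ^ 2 ∂(uniformLaw ξ)) d₀ x (t, v) ^ 2 ∂(cubeLaw d ξ)
      ≤ digamma β C Mc d₀ hd₀ ^ 2 * momentConst d d₀ ρ := by
  set s := ∫ u, u ^ 2 ∂(uniformLaw ξ) with hs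
  have hsξ : s = ξ ^ 2 / 3 := integral_sq_uniformLaw hξ
  have hs0 : 0 < s := by rw [hsξ]; positivity
  set F := digamma β C Mc d₀ hd₀
  set c : Fin d → ℝ := fun k => weight (g k) (x k) (t k) with hcdef
  have hesp : ∀ p, Continuous fun v : Fin d → ℝ => esp p fun k => c k * v k := fun p =>
    (continuous_esp p).comp (by fun_prop)
  have hint : ∀ p, Integrable (fun v : Fin d → ℝ =>
      F ^ 2 * (6 * d / s) ^ p * esp p (fun k => c k * v k) ^ 2) (cubeLaw d ξ) := fun p =>
    integrable_cubeLaw_of_continuous hξ (by have := hesp p; fun_prop)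
  have hpt : ∀ᵐ v ∂(cubeLaw d ξ), emulatorTerm M g β C h s d₀ x (t, v) ^ 2
      ≤ ∑ p ∈ Finset.Icc 1 d₀, F ^ 2 * (6 * d / s) ^ p * esp p (fun k => c k * v k) ^ 2 := by
    filter_upwards [ae_abs_le_cubeLaw d hξ] with v hv
    have he := euclid_nonneg v
    have h1 : |emulatorTerm M g β C h s d₀ x (t, v)|
        ≤ ∑ p ∈ Finset.Icc 1 d₀, F * ((euclid v / s) ^ p * |esp p fun k => c k * v k|) := by
      refine (Finset.abs_sum_le_sum_abs _ _).trans (Finset.sum_le_sum fun p hp => ?_)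
      rw [abs_mul, esp_Rvec, abs_mul, abs_of_pos (by positivity : 0 < (1 / (h * s)) ^ p)]
      refine (mul_le_mul_of_nonneg_right
        (abs_fdiff_le_digamma hd₀ hp (H p hp) (hC p hp) hh t v) (by positivity)).trans_eq ?_
      rw [div_pow, div_pow, mul_pow]
      field_simp
      change F * euclid v ^ p * 1 ^ p * |esp p fun k => c k * v k| = _
      ring
    rw [← sq_abs]
    refine (pow_le_pow_left₀ (abs_nonneg _) h1 2).trans ((sq_sum_Icc_le d₀ _).trans
      (Finset.sum_le_sum fun p _ => ?_))
    -- The `6` is the `2` of the weighted Cauchy–Schwarz inequality times the `3` in `‖v‖² ≤ dξ² =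
    -- 3ds`.
    have h2 : 2 * (euclid v / s) ^ 2 ≤ 6 * d / s := by
      rw [div_pow, mul_div_assoc', div_le_div_iff₀ (by positivity) hs0]
      have h3 : euclid v ^ 2 ≤ d * (3 * s) := by
        rw [hsξ]; exact (euclid_sq_le hv).trans_eq (by ring)
      nlinarith [mul_le_mul_of_nonneg_left h3 hs0.le]
    calc 2 ^ p * (F * ((euclid v / s) ^ p * |esp p fun k => c k * v k|)) ^ 2
        = F ^ 2 * (2 * (euclid v / s) ^ 2) ^ p * esp p (fun k => c k * v k) ^ 2 := by
          rw [mul_pow, mul_pow, sq_abs, mul_pow, ← pow_mul, ← pow_mul, mul_comm p 2]; ring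
      _ ≤ _ := by gcongr
  refine (integral_mono_of_nonneg (Eventually.of_forall fun v => sq_nonneg _)
    (integrable_finsetSum _ fun p _ => hint p) hpt).trans ?_
  rw [integral_finsetSum _ fun p _ => hint p, momentConst, Finset.mul_sum]
  refine Finset.sum_le_sum fun p _ => ?_
  rw [integral_const_mul, integral_esp_sq hξ]
  have h4 : esp p (fun k => c k ^ 2) ≤ d.choose p * (1 / ρ ^ 2) ^ p := by
    refine (le_abs_self _).trans (abs_esp_le (fun k => ?_) p)
    rw [abs_pow, ← one_div_pow]
    exact pow_le_pow_left₀ (abs_nonneg _) (ht k) 2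
  calc F ^ 2 * (6 * d / s) ^ p * (s ^ p * esp p fun k => c k ^ 2)
      ≤ F ^ 2 * (6 * d / s) ^ p * (s ^ p * (d.choose p * (1 / ρ ^ 2) ^ p)) := by gcongr
    _ = F ^ 2 * (d.choose p * (6 * d / ρ ^ 2) ^ p) := by
      rw [div_pow, div_pow, div_pow, one_pow]
      field_simp

/-! ### Bias -/

/-- The sum of the terms of orders `1, …, d₀` of the integrand of the derivative-based ANOVA
expansion. -/
noncomputable def anovaIntegrand {d : ℕ} (g : Fin d → ℝ → ℝ) (D : (Fin d → ℕ) → (Fin d → ℝ) → ℝ)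
    (d₀ : ℕ) (x t : Fin d → ℝ) : ℝ :=
  ∑ p ∈ Finset.Icc 1 d₀, ∑ w ∈ Finset.powersetCard p (Finset.univ : Finset (Fin d)),
    D (crossIndex w) t * ∏ k ∈ w, weight (g k) (x k) (t k)

/-- The constant of the second-order approximation of cross-partial derivatives of order `p`. -/
noncomputable def diffConst {L : ℕ} (d : ℕ) (β : Fin L → ℝ) (C : ℕ → Fin L → ℝ) (Mc : ℕ → ℝ)
    (ξ : ℝ) (p : ℕ) : ℝ :=
  Mc (p + 2) * Gam β C p (p + 2) * (Real.sqrt d * ξ) ^ (p + 2) * ξ ^ p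
    / (∫ u, u ^ 2 ∂(uniformLaw ξ)) ^ p

/-- The constant of the bias of the emulator. -/
noncomputable def biasConst {L : ℕ} (d d₀ : ℕ) (β : Fin L → ℝ) (C : ℕ → Fin L → ℝ) (Mc : ℕ → ℝ)
    (ρ ξ : ℝ) : ℝ :=
  ∑ p ∈ Finset.Icc 1 d₀, d.choose p * ((1 / ρ) ^ p * diffConst d β C Mc ξ p)

/-- For fixed `t` the weights factor out of the integral over `v`, so each subset `w` of size `p`
costs at most `ρ^{-p}` times the second-order error of its cross-partial. -/
theorem abs_integral_emulatorTerm_sub_le {d d₀ : ℕ} {M : (Fin d → ℝ) → ℝ} (hM : Continuous M)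
    {D : (Fin d → ℕ) → (Fin d → ℝ) → ℝ} {Mc : ℕ → ℝ} (hMc : ∀ p ∈ Finset.Icc 1 d₀, 0 ≤ Mc (p + 2))
    (H : ∀ p ∈ Finset.Icc 1 d₀, MemHolder M D (p + 2) (Mc (p + 2))) {g : Fin d → ℝ → ℝ}
    {β : Fin (d₀ + 1) → ℝ} {C : ℕ → Fin (d₀ + 1) → ℝ}
    (hC : ∀ p ∈ Finset.Icc 1 d₀, CoeffConstraints (d₀ - 1) (d₀ + 1) β p (C p))
    {h ρ ξ : ℝ} (hh : 0 < h) (hξ : 0 < ξ) {x t : Fin d → ℝ}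
    (ht : ∀ k, |weight (g k) (x k) (t k)| ≤ 1 / ρ) :
    |∫ v, emulatorTerm M g β C h (∫ u, u ^ 2 ∂(uniformLaw ξ)) d₀ x (t, v) ∂(cubeLaw d ξ)
        - anovaIntegrand g D d₀ x t| ≤ biasConst d d₀ β C Mc ρ ξ * h ^ 2 := by
  set s := ∫ u, u ^ 2 ∂(uniformLaw ξ) with hs
  have hF : ∀ p, Continuous fun v => fdiff β (C p) M h t v := fun p =>
    (continuous_fdiff hM β (C p) h).comp (Continuous.prodMk_right t)
  have e : ∀ v : Fin d → ℝ, emulatorTerm M g β C h s d₀ x (t, v) = ∑ p ∈ Finset.Icc 1 d₀,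
      ∑ w ∈ Finset.powersetCard p (Finset.univ : Finset (Fin d)),
        (∏ k ∈ w, weight (g k) (x k) (t k)) *
          (fdiff β (C p) M h t v * ∏ k ∈ w, (v k / (h * s))) := fun v => by
    refine Finset.sum_congr rfl fun p _ => ?_
    rw [esp, Finset.mul_sum]
    refine Finset.sum_congr rfl fun w _ => ?_
    have : ∏ k ∈ w, Rvec g (fun _ => h) s x t v k
        = (∏ k ∈ w, weight (g k) (x k) (t k)) * ∏ k ∈ w, (v k / (h * s)) := by
      rw [← Finset.prod_mul_distrib]
      exact Finset.prod_congr rfl fun k _ => by rw [Rvec]; ring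
    rw [this]; ring
  have hint : ∀ (p : ℕ) (w : Finset (Fin d)), Integrable (fun v =>
      (∏ k ∈ w, weight (g k) (x k) (t k)) *
          (fdiff β (C p) M h t v * ∏ k ∈ w, (v k / (h * s)))) (cubeLaw d ξ) := fun p w =>
    integrable_cubeLaw_of_continuous hξ (by have := hF p; fun_prop)
  simp only [e]
  rw [integral_finsetSum _ fun p _ => integrable_finsetSum _ fun w _ => hint p w,
    anovaIntegrand, ← Finset.sum_sub_distrib, biasConst, Finset.sum_mul]
  refine (Finset.abs_sum_le_sum_abs _ _).trans (Finset.sum_le_sum fun p hp => ?_)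
  rw [integral_finsetSum _ fun w _ => hint p w, ← Finset.sum_sub_distrib]
  refine (Finset.abs_sum_le_sum_abs _ _).trans ?_
  refine (Finset.sum_le_sum (g := fun _ => (1 / ρ) ^ p * diffConst d β C Mc ξ p * h ^ 2)
    fun w hw => ?_).trans_eq ?_
  · have hw := (Finset.mem_powersetCard.1 hw).2
    subst hw
    rw [integral_const_mul, mul_comm (D _ _), ← mul_sub, abs_mul, mul_assoc]
    exact mul_le_mul (abs_prod_le (v := fun k => weight (g k) (x k) (t k)) ht w)
      (abs_integral_fdiff_mul_prod_sub_le hξ (hMc _ hp) w (H _ hp) hM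
        (fun r hr => (hC _ hp).sum_eq hp hr) hh t) (abs_nonneg _)
      -- Nonnegativity of `1 / ρ` is read off from `ht` at a point of `w`, which is nonempty since
      -- `p ≥ 1`.
      (pow_nonneg (by
        obtain ⟨k, -⟩ := Finset.card_pos.1 (Finset.mem_Icc.1 hp).1
        exact (abs_nonneg _).trans (ht k)) _)
  · simp only [Finset.sum_const, Finset.card_powersetCard, Finset.card_univ, Fintype.card_fin,
      nsmul_eq_mul]
    ring

/-! ### Cross-partial derivatives of Hölder functions -/

section CrossPartial

variable {d d₀ : ℕ} {M : (Fin d → ℝ) → ℝ} {D : (Fin d → ℕ) → (Fin d → ℝ) → ℝ} {A : ℝ}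
  {β c : Fin (d₀ + 1) → ℝ} {w : Finset (Fin d)}

/-- At `h = ξ = 1` the cross-partial lies within a constant of an averaged finite difference of `M`,
which is bounded because `M` is. -/
theorem exists_abs_crossPartial_le (hA : 0 ≤ A) (H : MemHolder M D (w.card + 2) A)
    (hM : Continuous M) {b : ℝ} (hb : ∀ x, |M x| ≤ b)
    (hc : ∀ r ≤ w.card, ∑ l, c l * β l ^ r = if w.card = r then 1 else 0) :
    ∃ B, ∀ t, |D (crossIndex w) t| ≤ B := by
  have := isProbabilityMeasure_cubeLaw d one_pos
  have hs0 : 0 < ∫ u, u ^ 2 ∂(uniformLaw 1) := by rw [integral_sq_uniformLaw one_pos]; norm_num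
  set s := ∫ u, u ^ 2 ∂(uniformLaw 1)
  have hb0 : 0 ≤ b := (abs_nonneg _).trans (hb 0)
  obtain ⟨K, hK⟩ : ∃ K, ∀ t, |∫ v, fdiff β c M 1 t v * ∏ k ∈ w, (v k / (1 * s)) ∂(cubeLaw d 1)
      - D (crossIndex w) t| ≤ K :=
    ⟨_, fun t => abs_integral_fdiff_mul_prod_sub_le one_pos hA w H hM hc one_pos t⟩
  refine ⟨(∑ l, |c l|) * b * (1 / s) ^ w.card + K, fun t => ?_⟩
  have h2 : |∫ v, fdiff β c M 1 t v * ∏ k ∈ w, (v k / (1 * s)) ∂(cubeLaw d 1)|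
      ≤ (∑ l, |c l|) * b * (1 / s) ^ w.card := by
    rw [← Real.norm_eq_abs]
    refine (norm_integral_le_of_norm_le_const (C := (∑ l, |c l|) * b * (1 / s) ^ w.card)
      ?_).trans_eq (by simp)
    filter_upwards [ae_abs_le_cubeLaw d one_pos] with v hv
    rw [Real.norm_eq_abs, abs_mul]
    refine mul_le_mul (abs_fdiff_le hb β c 1 t v)
      (abs_prod_le (v := fun k => v k / (1 * s)) (fun k => ?_) w) (abs_nonneg _) (by positivity)
    rw [abs_div, one_mul, abs_of_pos hs0]
    exact div_le_div_of_nonneg_right (hv k) hs0.le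
  have h3 := (abs_sub_abs_le_abs_sub _ _).trans ((abs_sub_comm _ _).trans_le (hK t))
  linarith

/-- The cross-partial is the pointwise limit of averaged finite differences with `h = 1 / (n + 1)`,
each measurable as a parameter integral. -/
theorem measurable_crossPartial (hA : 0 ≤ A) (H : MemHolder M D (w.card + 2) A)
    (hM : Continuous M)
    (hc : ∀ r ≤ w.card, ∑ l, c l * β l ^ r = if w.card = r then 1 else 0) :
    Measurable (D (crossIndex w)) := by
  have := isProbabilityMeasure_cubeLaw d one_pos
  have hn : ∀ n : ℕ, (0 : ℝ) < 1 / ((n : ℝ) + 1) := fun n => by positivity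
  refine measurable_of_tendsto_metrizable (f := fun n t =>
    ∫ v, fdiff β c M (1 / ((n : ℝ) + 1)) t v *
      ∏ k ∈ w, (v k / (1 / ((n : ℝ) + 1) * ∫ u, u ^ 2 ∂(uniformLaw 1))) ∂(cubeLaw d 1))
    (fun n => ?_) (tendsto_pi_nhds.2 fun t => ?_)
  · have h1 : Continuous fun q : (Fin d → ℝ) × (Fin d → ℝ) =>
        fdiff β c M (1 / ((n : ℝ) + 1)) q.1 q.2 *
          ∏ k ∈ w, (q.2 k / (1 / ((n : ℝ) + 1) * ∫ u, u ^ 2 ∂(uniformLaw 1))) :=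
      (continuous_fdiff hM β c _).mul (by fun_prop)
    exact (h1.stronglyMeasurable.integral_prod_right' (ν := cubeLaw d 1)).measurable
  · rw [tendsto_iff_norm_sub_tendsto_zero]
    refine squeeze_zero (fun _ => norm_nonneg _)
      (fun n => abs_integral_fdiff_mul_prod_sub_le one_pos hA w H hM hc (hn n) t) ?_
    simpa using (tendsto_one_div_add_atTop_nhds_zero_nat (𝕜 := ℝ)).pow 2 |>.const_mul _

end CrossPartial

/-! ### Mean squared errors of sample means -/

/-- Bias–variance decomposition, with each variance bounded by the second moment. -/
theorem integral_sq_mean_sub_le {S : Type*} [MeasurableSpace S] {P : Measure S}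
    [IsProbabilityMeasure P] {N : ℕ} (hN : 1 ≤ N) {Y : Fin N → S → ℝ} (hY : ∀ i, MemLp (Y i) 2 P)
    (hind : iIndepFun Y P) {e m B : ℝ} (he : ∀ i, ∫ s, Y i s ∂P = e)
    (hB : ∀ i, ∫ s, Y i s ^ 2 ∂P ≤ B) :
    ∫ s, ((1 / (N : ℝ)) * ∑ i, Y i s - m) ^ 2 ∂P ≤ B / N + (e - m) ^ 2 := by
  have hN0 : (0 : ℝ) < N := by exact_mod_cast hN
  have hsum : MemLp (fun s => ∑ i, Y i s) 2 P := memLp_finsetSum _ fun i _ => hY i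
  have hZ : MemLp (fun s => (1 / (N : ℝ)) * ∑ i, Y i s) 2 P := hsum.const_mul _
  have hZm : MemLp (fun s => (1 / (N : ℝ)) * ∑ i, Y i s - m) 2 P := hZ.sub (memLp_const m)
  have hmean : ∫ s, ((1 / (N : ℝ)) * ∑ i, Y i s - m) ∂P = e - m := by
    rw [integral_sub (hZ.integrable one_le_two) (integrable_const m), integral_const_mul,
      integral_finsetSum _ fun i _ => (hY i).integrable one_le_two]
    simp only [he]
    simp
    field_simp
  have hvar : Var[fun s => (1 / (N : ℝ)) * ∑ i, Y i s - m; P] ≤ B / N := by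
    rw [variance_sub_const hZ.aestronglyMeasurable, variance_const_mul]
    have h1 : Var[fun s => ∑ i, Y i s; P] = ∑ i, Var[Y i; P] := by
      have := IndepFun.variance_sum (X := Y) (s := Finset.univ) (μ := P) (fun i _ => hY i)
        fun i _ j _ hij => hind.indepFun hij
      rw [← this]
      congr 1
      ext s; simp
    rw [h1]
    calc (1 / (N : ℝ)) ^ 2 * ∑ i, Var[Y i; P] ≤ (1 / (N : ℝ)) ^ 2 * ∑ _i : Fin N, B := by
          gcongr with i
          exact (variance_le_expectation_sq (hY i).aestronglyMeasurable).trans (hB i)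
      _ = B / N := by simp; field_simp
  have h2 := variance_eq_sub hZm
  rw [hmean] at h2
  have h3 : ∫ s, ((1 / (N : ℝ)) * ∑ i, Y i s - m) ^ 2 ∂P
      = Var[fun s => (1 / (N : ℝ)) * ∑ i, Y i s - m; P] + (e - m) ^ 2 := by
    rw [h2, sub_add_cancel]
    rfl
  rw [h3]
  gcongr

/-! ### Mean squared error of the emulator -/

section Error

variable {d d₀ : ℕ} {Mc : ℕ → ℝ} {ρ : ℝ} {Ω : Set (Fin d → ℝ)} {f g : Fin d → ℝ → ℝ}
  {M : (Fin d → ℝ) → ℝ} {D : (Fin d → ℕ) → (Fin d → ℝ) → ℝ}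

theorem Admissible.abs_le (hA : Admissible d₀ Mc ρ Ω f g M D) (y : Fin d → ℝ) : |M y| ≤ Mc 0 :=
  (hA.holder 0 (Nat.zero_le _)).abs_le y

theorem Admissible.holder_one (hA : Admissible d₀ Mc ρ Ω f g M D) : MemHolder M D 1 (Mc 1) :=
  hA.holder 1 (le_max_of_le_right (by omega))

theorem sum_card_le_eq {d : ℕ} (d₀ : ℕ) (F : Finset (Fin d) → ℝ) :
    ∑ w : Finset (Fin d) with w.card ≤ d₀, F w
      = F ∅ + ∑ p ∈ Finset.Icc 1 d₀, ∑ w ∈ Finset.powersetCard p Finset.univ, F w := by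
  have h0 : (∅ : Finset (Fin d)) ∈ Finset.univ.filter fun w : Finset (Fin d) => w.card ≤ d₀ := by
    simp
  rw [← Finset.add_sum_erase _ _ h0, ← Finset.sum_fiberwise_of_maps_to (g := Finset.card)
    (t := Finset.Icc 1 d₀)]
  · congr 1
    refine Finset.sum_congr rfl fun p hp => Finset.sum_congr ?_ fun _ _ => rfl
    ext w
    simp only [Finset.mem_Icc, Finset.mem_filter, Finset.mem_erase, Finset.mem_univ, true_and,
      Finset.mem_powersetCard, Finset.subset_univ] at hp ⊢
    rw [← Finset.nonempty_iff_ne_empty, ← Finset.card_pos]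
    omega
  · intro w hw
    simp only [Finset.mem_filter, Finset.mem_erase, Finset.mem_univ, true_and] at hw
    rw [← Finset.nonempty_iff_ne_empty, ← Finset.card_pos] at hw
    exact Finset.mem_Icc.2 hw

/-- Boundedness and measurability of the cross-partials come from their approximation by finite
differences. Integrability is what permits exchanging the ANOVA sum with the integral. -/
theorem Admissible.integrable_anova (hA : Admissible d₀ Mc ρ Ω f g M D)
    {β : Fin (d₀ + 1) → ℝ} {C : ℕ → Fin (d₀ + 1) → ℝ}
    (hC : ∀ p ∈ Finset.Icc 1 d₀, CoeffConstraints (d₀ - 1) (d₀ + 1) β p (C p))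
    (hMc : ∀ α ≤ max d (d₀ + 2), 0 < Mc α) (hρ : 0 < ρ) (x : Fin d → ℝ) {w : Finset (Fin d)}
    (hw : w.card ∈ Finset.Icc 1 d₀) :
    Integrable (fun t => D (crossIndex w) t * ∏ k ∈ w, weight (g k) (x k) (t k))
      (inputLaw g) := by
  have := isProbabilityMeasure_inputLaw hA.pdf_X'
  have hle : w.card + 2 ≤ max d (d₀ + 2) :=
    le_max_of_le_right (by have := (Finset.mem_Icc.1 hw).2; omega)
  have hM := hA.holder_one.continuous
  have hc : ∀ r ≤ w.card, ∑ l, C w.card l * β l ^ r = if w.card = r then 1 else 0 :=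
    fun r hr => (hC _ hw).sum_eq hw hr
  obtain ⟨B, hB⟩ := exists_abs_crossPartial_le (hMc _ hle).le (hA.holder _ hle) hM hA.abs_le hc
  have hm := measurable_crossPartial (hMc _ hle).le (hA.holder _ hle) hM hc
  refine Integrable.of_bound (C := B * (1 / ρ) ^ w.card) ?_ ?_
  · exact (hm.mul (Finset.measurable_prod _ fun k _ =>
      (measurable_weight (hA.pdf_X' k).1 (x k)).comp (measurable_pi_apply k))).aestronglyMeasurable
  · filter_upwards [ae_abs_weight_le hA.pdf_X' hρ hA.lower x] with t ht
    rw [Real.norm_eq_abs, abs_mul]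
    exact mul_le_mul (hB t) (abs_prod_le (v := fun k => weight (g k) (x k) (t k)) ht w)
      (abs_nonneg _) ((abs_nonneg _).trans (hB t))

theorem Admissible.integrable_anovaIntegrand (hA : Admissible d₀ Mc ρ Ω f g M D)
    {β : Fin (d₀ + 1) → ℝ} {C : ℕ → Fin (d₀ + 1) → ℝ}
    (hC : ∀ p ∈ Finset.Icc 1 d₀, CoeffConstraints (d₀ - 1) (d₀ + 1) β p (C p))
    (hMc : ∀ α ≤ max d (d₀ + 2), 0 < Mc α) (hρ : 0 < ρ) (x : Fin d → ℝ) :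
    Integrable (anovaIntegrand g D d₀ x) (inputLaw g) :=
  integrable_finsetSum _ fun _ hp => integrable_finsetSum _ fun _ hw =>
    hA.integrable_anova hC hMc hρ x ((Finset.mem_powersetCard.1 hw).2 ▸ hp)

/-- The term `w = ∅` of the interaction expansion is `E[M(X')]`, exactly what centring removes. -/
theorem Admissible.centred_eq (hA : Admissible d₀ Mc ρ Ω f g M D)
    {β : Fin (d₀ + 1) → ℝ} {C : ℕ → Fin (d₀ + 1) → ℝ}
    (hC : ∀ p ∈ Finset.Icc 1 d₀, CoeffConstraints (d₀ - 1) (d₀ + 1) β p (C p))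
    (hMc : ∀ α ≤ max d (d₀ + 2), 0 < Mc α) (hρ : 0 < ρ) {x : Fin d → ℝ} (hx : x ∈ Ω) :
    centred M g x = ∫ t, anovaIntegrand g D d₀ x t ∂(inputLaw g) := by
  have hint : ∀ p ∈ Finset.Icc 1 d₀, ∀ w ∈ Finset.powersetCard p (Finset.univ : Finset (Fin d)),
      Integrable (fun t => D (crossIndex w) t * ∏ k ∈ w, weight (g k) (x k) (t k))
        (inputLaw g) := fun p hp w hw =>
    hA.integrable_anova hC hMc hρ x ((Finset.mem_powersetCard.1 hw).2 ▸ hp)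
  have h1 := abs_nonpos_iff.1 (hA.interaction x hx)
  rw [sum_card_le_eq] at h1
  have h0 : crossIndex (∅ : Finset (Fin d)) = 0 := by ext; simp [crossIndex]
  simp only [Finset.prod_empty, mul_one, h0, hA.holder_one.deriv_zero] at h1
  unfold centred anovaIntegrand
  rw [integral_finsetSum _ fun p hp => integrable_finsetSum _ (hint p hp)]
  rw [Finset.sum_congr rfl fun p hp => integral_finsetSum _ (hint p hp)]
  linarith

/-- Nonasymptotic bound on the mean squared error of the emulator: variance and squared bias. -/
theorem Admissible.MSE_le (hA : Admissible d₀ Mc ρ Ω f g M D) (hd₀ : 1 ≤ d₀)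
    {β : Fin (d₀ + 1) → ℝ} {C : ℕ → Fin (d₀ + 1) → ℝ}
    (hC : ∀ p ∈ Finset.Icc 1 d₀, CoeffConstraints (d₀ - 1) (d₀ + 1) β p (C p))
    (hMc : ∀ α ≤ max d (d₀ + 2), 0 < Mc α) (hρ : 0 < ρ) {ξ h : ℝ} (hξ : 0 < ξ) (hh : 0 < h)
    {N : ℕ} (hN : 1 ≤ N) {S : Type*} [MeasurableSpace S] {P : Measure S} [IsProbabilityMeasure P]
    {X' V : Fin N → S → Fin d → ℝ} (hS : IsSample P g ξ X' V) {x : Fin d → ℝ} (hx : x ∈ Ω) :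
    MSE P M g β C h ξ d₀ X' V x
      ≤ ENNReal.ofReal (digamma β C Mc d₀ hd₀ ^ 2 * momentConst d d₀ ρ / N
          + (biasConst d d₀ β C Mc ρ ξ * h ^ 2) ^ 2) := by
  have := isProbabilityMeasure_inputLaw hA.pdf_X'
  have := isProbabilityMeasure_cubeLaw d hξ
  have hM := hA.holder_one.continuous
  have hs0 : 0 < ∫ u, u ^ 2 ∂(uniformLaw ξ) := by rw [integral_sq_uniformLaw hξ]; positivity
  set Φ := emulatorTerm M g β C h (∫ u, u ^ 2 ∂(uniformLaw ξ)) d₀ x with hΦ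
  have hΦm : Measurable Φ := measurable_emulatorTerm hM (fun j => (hA.pdf_X' j).1) _ _ _ _ _ _
  have hwt := ae_abs_weight_le hA.pdf_X' hρ hA.lower x
  obtain ⟨Q, hQ⟩ : ∃ Q, ∀ᵐ q ∂((inputLaw g).prod (cubeLaw d ξ)), ‖Φ q‖ ≤ Q :=
    ⟨_, ((Measure.quasiMeasurePreserving_fst.ae hwt).and
      (Measure.quasiMeasurePreserving_snd.ae (ae_abs_le_cubeLaw d hξ))).mono
      fun q hq => abs_emulatorTerm_le hA.abs_le hh hs0 hq.1 hq.2⟩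
  have hΦ2 : MemLp Φ 2 ((inputLaw g).prod (cubeLaw d ξ)) :=
    MemLp.of_bound hΦm.aestronglyMeasurable Q hQ
  have hpair : ∀ i, Measurable fun s => (X' i s, V i s) := fun i => (hS.1 i).prodMk (hS.2.1 i)
  have hYm : ∀ i, MemLp (fun s => Φ (X' i s, V i s)) 2 P := fun i => by
    rw [← hS.2.2.2 i] at hΦ2
    exact hΦ2.comp_of_map (hpair i).aemeasurable
  have hYmean : ∀ i, ∫ s, Φ (X' i s, V i s) ∂P
      = ∫ q, Φ q ∂((inputLaw g).prod (cubeLaw d ξ)) := fun i => by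
    rw [← hS.2.2.2 i, integral_map (hpair i).aemeasurable hΦm.aestronglyMeasurable]
  have hYsq : ∀ i, ∫ s, Φ (X' i s, V i s) ^ 2 ∂P
      ≤ digamma β C Mc d₀ hd₀ ^ 2 * momentConst d d₀ ρ := fun i => by
    have h1 : ∫ s, Φ (X' i s, V i s) ^ 2 ∂P
        = ∫ q, Φ q ^ 2 ∂((inputLaw g).prod (cubeLaw d ξ)) := by
      rw [← hS.2.2.2 i, integral_map (hpair i).aemeasurable
        (hΦm.pow_const 2).aestronglyMeasurable]
    rw [h1, integral_prod _ hΦ2.integrable_sq]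
    refine (integral_mono_of_nonneg
      (Eventually.of_forall fun t => integral_nonneg fun v => sq_nonneg _)
      (integrable_const (digamma β C Mc d₀ hd₀ ^ 2 * momentConst d d₀ ρ)) ?_).trans_eq (by simp)
    filter_upwards [hwt] with t ht
    exact integral_emulatorTerm_sq_le hd₀ (fun p hp => hA.holder p
      (le_max_of_le_right (by have := (Finset.mem_Icc.1 hp).2; omega))) hC hh hξ ht
  have hbias : |∫ q, Φ q ∂((inputLaw g).prod (cubeLaw d ξ)) - centred M g x|
      ≤ biasConst d d₀ β C Mc ρ ξ * h ^ 2 := by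
    have hΦ1 := hΦ2.integrable one_le_two
    rw [integral_prod _ hΦ1, hA.centred_eq hC hMc hρ hx, ← integral_sub hΦ1.integral_prod_left
      (hA.integrable_anovaIntegrand hC hMc hρ x), ← Real.norm_eq_abs]
    refine (norm_integral_le_of_norm_le_const (C := biasConst d d₀ β C Mc ρ ξ * h ^ 2)
      ?_).trans_eq (by simp)
    filter_upwards [hwt] with t ht
    have hle : ∀ p ∈ Finset.Icc 1 d₀, p + 2 ≤ max d (d₀ + 2) := fun p hp =>
      le_max_of_le_right (by have := (Finset.mem_Icc.1 hp).2; omega)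
    exact abs_integral_emulatorTerm_sub_le hM (fun p hp => (hMc _ (hle p hp)).le)
      (fun p hp => hA.holder _ (hle p hp)) hC hh hξ ht
  have hind : iIndepFun (fun i s => Φ (X' i s, V i s)) P :=
    hS.2.2.1.comp (fun _ => Φ) fun _ => hΦm
  have hmain := integral_sq_mean_sub_le hN hYm hind (m := centred M g x) hYmean hYsq
  have hint : Integrable (fun s => ((1 / (N : ℝ)) * ∑ i, Φ (X' i s, V i s) - centred M g x) ^ 2)
      P := (((memLp_finsetSum _ fun i _ => hYm i).const_mul _).sub (memLp_const _)).integrable_sq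
  simp only [MSE, emulator_eq]
  rw [← ofReal_integral_eq_lintegral_ofReal hint (Eventually.of_forall fun s => sq_nonneg _)]
  refine ENNReal.ofReal_le_ofReal (hmain.trans ?_)
  exact add_le_add le_rfl (sq_le_sq.2 (hbias.trans (le_abs_self _)))

end Error

/-! ### Error bounds -/

/-- The squared bias times `N` is of order `N^{1 - 4η}`, which tends to zero exactly because `η >
1/4`. -/
theorem tendsto_mul_remainder {a η : ℝ} (hη : 1 / 4 < η) (S b : ℝ) :
    Tendsto (fun N : ℕ => (N : ℝ) * (S / N + (b * (a * (N : ℝ) ^ (-η)) ^ 2) ^ 2)) atTop (𝓝 S) := by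
  have h1 : Tendsto (fun N : ℕ => S + b ^ 2 * a ^ 4 * (N : ℝ) ^ (-(4 * η - 1))) atTop (𝓝 S) := by
    have := (tendsto_rpow_neg_atTop (y := 4 * η - 1) (by linarith)).comp
      tendsto_natCast_atTop_atTop
    simpa using (this.const_mul (b ^ 2 * a ^ 4)).const_add S
  refine h1.congr' ?_
  filter_upwards [eventually_ge_atTop 1] with N hN
  have hN0 : (0 : ℝ) < N := by exact_mod_cast hN
  have e : (N : ℝ) ^ (-(4 * η - 1)) = N * ((N : ℝ) ^ (-η)) ^ 4 := by
    rw [← Real.rpow_mul_natCast hN0.le, ← Real.rpow_one_add' hN0.le]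
    · congr 1; push_cast; ring
    · push_cast; linarith
  rw [e]
  field_simp

/-- The remainder carries the full variance bound `S / N` and the squared bias. Since `N * R N → S`,
the strict inequality `S < K` gives the eventual bound. The pointwise estimate is uniform in `x`, so
integrating over the law of `X` preserves it. -/
theorem errorBound_of_le {d d₀ : ℕ} (hd₀ : 1 ≤ d₀) {β : Fin (d₀ + 1) → ℝ}
    {C : ℕ → Fin (d₀ + 1) → ℝ} {Mc : ℕ → ℝ} {ρ ξ a η B S K : ℝ}
    (hC : ∀ p ∈ Finset.Icc 1 d₀, CoeffConstraints (d₀ - 1) (d₀ + 1) β p (C p))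
    (hMc : ∀ α ≤ max d (d₀ + 2), 0 < Mc α) (hρ : 0 < ρ) (hξ : 0 < ξ) (ha : 0 < a)
    (hη : 1 / 4 < η) (hB : 0 ≤ B) (hS : digamma β C Mc d₀ hd₀ ^ 2 * momentConst d d₀ ρ ≤ S)
    (hK : S < K) : ErrorBound d d₀ β C Mc ρ ξ a η B K := by
  have hlim := tendsto_mul_remainder (a := a) hη S (biasConst d d₀ β C Mc ρ ξ)
  refine ⟨fun N => S / N + (biasConst d d₀ β C Mc ρ ξ * (a * (N : ℝ) ^ (-η)) ^ 2) ^ 2, ?_,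
    (hlim.eventually_lt_const hK).mono fun N h => h.le, ?_⟩
  · have h1 := (hlim.isBigO_one ℝ).mul (isBigO_refl (fun N : ℕ => (N : ℝ)⁻¹) atTop)
    refine h1.congr' ?_ (Eventually.of_forall fun N => one_mul _)
    filter_upwards [eventually_ge_atTop 1] with N hN
    have hN0 : (0 : ℝ) < N := by exact_mod_cast hN
    field_simp
  · intro Ω f g M D hA N hN T _ P _ X' V hs
    have hN0 : (0 : ℝ) < N := by exact_mod_cast hN
    have := isProbabilityMeasure_inputLaw hA.pdf_X
    have hx : ∀ x ∈ Ω, MSE P M g β C (a * (N : ℝ) ^ (-η)) ξ d₀ X' V x ≤ ENNReal.ofReal (B / N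
        + (S / N + (biasConst d d₀ β C Mc ρ ξ * (a * (N : ℝ) ^ (-η)) ^ 2) ^ 2)) := fun x hx => by
      refine (hA.MSE_le hd₀ hC hMc hρ hξ (by positivity) hN hs hx).trans
        (ENNReal.ofReal_le_ofReal ?_)
      have h1 : 0 ≤ B / N := by positivity
      have h2 : digamma β C Mc d₀ hd₀ ^ 2 * momentConst d d₀ ρ / N ≤ S / N := by gcongr
      linarith
    refine ⟨hx, ?_⟩
    calc ∫⁻ x, MSE P M g β C (a * (N : ℝ) ^ (-η)) ξ d₀ X' V x ∂(inputLaw f)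
        ≤ ∫⁻ _, ENNReal.ofReal (B / N
          + (S / N + (biasConst d d₀ β C Mc ρ ξ * (a * (N : ℝ) ^ (-η)) ^ 2) ^ 2)) ∂(inputLaw f) :=
          lintegral_mono_ae (hA.supported.mono fun x h => hx x h)
      _ = _ := by simp

/-! ### The constants -/

theorem sum_Icc_choose_mul_pow_le (d d₀ : ℕ) {y : ℝ} (hy : 0 ≤ y) (hd : d₀ ≤ d) :
    ∑ p ∈ Finset.Icc 1 d₀, (d.choose p : ℝ) * y ^ p ≤ (y + 1) ^ d := by
  rw [add_pow]
  refine (Finset.sum_le_sum_of_subset_of_nonneg (t := Finset.range (d + 1)) (fun p hp => ?_)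
    fun p _ _ => by positivity).trans_eq (Finset.sum_congr rfl fun p _ => by simp [mul_comm])
  have := (Finset.mem_Icc.1 hp).2
  exact Finset.mem_range.2 (by omega)

/-- With `q = (d + 0.8) / (3ρ²) ≥ 1`, one has `6d/ρ² ≤ 18q` and `q^p ≤ q^{d₀}`; the binomial theorem
then gives `(18 + 1)^d`. -/
theorem momentConst_le_of_one_le {d d₀ : ℕ} (hd : d₀ ≤ d) {ρ : ℝ} (hρ : 0 < ρ)
    (h : 3 * ρ ^ 2 ≤ (d : ℝ) + 0.8) :
    momentConst d d₀ ρ ≤ 19 ^ d * (((d : ℝ) + 0.8) / (3 * ρ ^ 2)) ^ d₀ := by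
  set q := ((d : ℝ) + 0.8) / (3 * ρ ^ 2) with hq
  have hq1 : 1 ≤ q := (one_le_div (by positivity)).2 h
  have h6 : 6 * d / ρ ^ 2 ≤ 18 * q := by
    rw [hq, mul_div_assoc', div_le_div_iff₀ (by positivity) (by positivity)]
    nlinarith [sq_nonneg ρ]
  calc momentConst d d₀ ρ ≤ ∑ p ∈ Finset.Icc 1 d₀, (d.choose p : ℝ) * 18 ^ p * q ^ d₀ := by
        refine Finset.sum_le_sum fun p hp => ?_
        rw [mul_assoc]
        have h1 : (6 * d / ρ ^ 2) ^ p ≤ 18 ^ p * q ^ d₀ :=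
          calc (6 * d / ρ ^ 2) ^ p ≤ (18 * q) ^ p := by gcongr
            _ = 18 ^ p * q ^ p := mul_pow _ _ _
            _ ≤ 18 ^ p * q ^ d₀ := by
              gcongr
              exact (Finset.mem_Icc.1 hp).2
        gcongr
    _ = (∑ p ∈ Finset.Icc 1 d₀, (d.choose p : ℝ) * 18 ^ p) * q ^ d₀ := by rw [Finset.sum_mul]
    _ ≤ 19 ^ d * q ^ d₀ := by
        gcongr
        exact (sum_Icc_choose_mul_pow_le d d₀ (by norm_num) hd).trans_eq (by norm_num)

/-- Each branch of `mainConst` multiplies the common power by a factor at least one: `2 d^{d₀}` or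
`2^d`. -/
theorem le_mainConst {d d₀ : ℕ} (hd₀ : 1 ≤ d₀) (hd : d₀ ≤ d) {ρ : ℝ} (hρ : 0 < ρ) (F : ℝ) :
    F ^ 2 * (((d : ℝ) + 0.8) / (3 * ρ ^ 2)) ^ d₀ ≤ mainConst d d₀ ρ F := by
  have hd1 : (1 : ℝ) ≤ d := by exact_mod_cast hd₀.trans hd
  unfold mainConst
  gcongr
  have hq : 0 < (((d : ℝ) + 0.8) / (3 * ρ ^ 2)) ^ d₀ := by positivity
  split_ifs
  · rw [mul_div_assoc, mul_pow]
    have := one_le_pow₀ hd1 (n := d₀)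
    nlinarith
  · exact le_mul_of_one_le_left hq.le (one_le_pow₀ (by norm_num))

/-- For this `ρ`, `6d/ρ² = 18 / (c₀ (d + 0.8)) ≤ 18/d`, and `(1 + 18/d)^d ≤ e^18` removes the
dimension. -/
theorem momentConst_le_exp {d d₀ : ℕ} (hd₀ : 1 ≤ d₀) (hd : d₀ ≤ d) {c₀ : ℝ} (hc : 1 < c₀) :
    momentConst d d₀ (Real.sqrt (c₀ * d * (d + 0.8) / 3)) ≤ Real.exp 18 := by
  have hd0 : (0 : ℝ) < d := by exact_mod_cast hd₀.trans hd
  have h6 : 6 * d / Real.sqrt (c₀ * d * (d + 0.8) / 3) ^ 2 ≤ 18 / d := by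
    rw [Real.sq_sqrt (by positivity), div_le_div_iff₀ (by positivity) hd0]
    nlinarith [mul_pos hd0 hd0, mul_pos (sub_pos.2 hc) (mul_pos hd0 hd0),
      mul_pos (sub_pos.2 hc) hd0]
  calc momentConst d d₀ (Real.sqrt (c₀ * d * (d + 0.8) / 3))
      ≤ ∑ p ∈ Finset.Icc 1 d₀, (d.choose p : ℝ) * (18 / d) ^ p :=
        Finset.sum_le_sum fun p _ => by gcongr
    _ ≤ (18 / d + 1) ^ d := sum_Icc_choose_mul_pow_le d d₀ (by positivity) hd
    _ ≤ Real.exp (18 / d) ^ d := by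
        gcongr
        exact Real.add_one_le_exp _
    _ = Real.exp 18 := by rw [← Real.exp_nat_mul]; congr 1; field_simp

end DbAnova

theorem mainTheorem5 :
    ∃ (κ : ℕ → ℝ) (κ₀ : ℝ),
    ∀ (d d₀ : ℕ) (hd₀ : 1 ≤ d₀), d₀ ≤ d →
    ∀ (β : Fin (d₀ + 1) → ℝ) (C : ℕ → Fin (d₀ + 1) → ℝ) (Mc : ℕ → ℝ) (ρ ξ a η : ℝ),
      Function.Injective β →
      (∀ p ∈ Finset.Icc 1 d₀, DbAnova.CoeffConstraints (d₀ - 1) (d₀ + 1) β p (C p)) →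
      (∀ α ≤ max d (d₀ + 2), 0 < Mc α) →
      0 < ρ → 0 < ξ → 0 < a → 1 / 4 < η → η < 1 →
      ξ ^ 2 ≤ ((d : ℝ) * Mc (d₀ + 2) * DbAnova.Gam β C d₀ (d₀ + 2) * (d.choose d₀ : ℝ)
        * (1 / (2 * ρ)) ^ d₀)⁻¹ →
      (3 * ρ ^ 2 ≤ (d : ℝ) + 0.8 →
        DbAnova.ErrorBound d d₀ β C Mc ρ ξ a η
          (DbAnova.mainConst d d₀ ρ (DbAnova.digamma β C Mc d₀ hd₀))
          (κ d * DbAnova.mainConst d d₀ ρ (DbAnova.digamma β C Mc d₀ hd₀))) ∧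
      (∀ c₀ : ℝ, 1 < c₀ → c₀ ≤ 2 → ρ = Real.sqrt (c₀ * d * (d + 0.8) / 3) →
        DbAnova.ErrorBound d d₀ β C Mc ρ ξ a η
          ((DbAnova.digamma β C Mc d₀ hd₀) ^ 2 / (c₀ - 1))
          (κ₀ * (DbAnova.digamma β C Mc d₀ hd₀) ^ 2)) := by
  -- The moment bounds give `19^d` and `e^18`; the added `1` provides the strict inequality `S < K`,
  -- as `F > 0`.
  refine ⟨fun d => 19 ^ d + 1, Real.exp 18 + 1, ?_⟩
  intro d d₀ hd₀ hd β C Mc ρ ξ a η _ hC hMc hρ hξ ha hη _ _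
  have hF : 0 < DbAnova.digamma β C Mc d₀ hd₀ :=
    DbAnova.digamma_pos hd₀ hC (hMc 1 (le_max_of_le_right (by omega)))
  set F := DbAnova.digamma β C Mc d₀ hd₀ with hFdef
  constructor
  · intro h3
    have hB := DbAnova.le_mainConst hd₀ hd hρ F
    have hB0 : 0 < DbAnova.mainConst d d₀ ρ F := lt_of_lt_of_le (by positivity) hB
    refine DbAnova.errorBound_of_le (S := 19 ^ d * DbAnova.mainConst d d₀ ρ F) hd₀ hC hMc hρ hξ ha
      hη hB0.le ?_ (by linarith)
    calc F ^ 2 * DbAnova.momentConst d d₀ ρ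
        ≤ F ^ 2 * (19 ^ d * (((d : ℝ) + 0.8) / (3 * ρ ^ 2)) ^ d₀) := by
          gcongr
          exact DbAnova.momentConst_le_of_one_le hd hρ h3
      _ = 19 ^ d * (F ^ 2 * (((d : ℝ) + 0.8) / (3 * ρ ^ 2)) ^ d₀) := by ring
      _ ≤ 19 ^ d * DbAnova.mainConst d d₀ ρ F := by gcongr
  · intro c₀ hc hc2 hρc
    have hc1 : 0 < c₀ - 1 := sub_pos.2 hc
    have hF2 : 0 < F ^ 2 := by positivity
    refine DbAnova.errorBound_of_le (S := Real.exp 18 * F ^ 2) hd₀ hC hMc hρ hξ ha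
      hη (by positivity) ?_ (by linarith)
    rw [mul_comm, hρc]
    gcongr
    exact DbAnova.momentConst_le_exp hd₀ hd hc
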